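/- **Setting.** Let $\mu$ be a Borel probability measure on $\mathbb R^d$ with a (measurable, nonnegative) density $p$ with respect to Lebesgue measure, and let $\nu=\sum_{i=1}^n q_i\delta_{y_i}$ be a probability measure with distinct atoms $y_1,\dots,y_n\in\mathbb R^d$ and weights $q_i>0$. Let $W_2^2(\mu,\nu)=\inf_{\pi\in\Pi(\mu,\nu)}\mathbb E_\pi\|x-y\|^2$, where $\Pi(\mu,\nu)$ is the set of couplings, and let $H(\nu)=-\sum_i q_i\log q_i$. For $\eta>0$ let $\pi_\eta$ be the minimizer over $\Pi(\mu,\nu)$ of $\mathbb E_\pi\|x-y\|^2+\eta^{-1}\mathrm{KL}(\pi\,\|\,\mu\otimes\nu)$. Let $(f^*,g^*)\in L^1(\mu)\times L^1(\nu)$ maximize $\mathbb E_\mu f+\mathbb E_\nu g$ subject to $f(x)+g(y)\le\|x-y\|^2$, normalized by $\mathbb E_\nu g^*=0$, and write $g_i^*=g^*(y_i)$. Define the power cells $S_i=\{x:\|x-y_i\|^2-g_i^*\le\|x-y_j\|^2-g_j^*\ \forall j\}$ and the slacks $\Delta_{ij}(x)=\|x-y_j\|^2-g_j^*-(\|x-y_i\|^2-g_i^*)$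 for $x\in S_i$. The optimal map $T$ sends $x$ to the minimizer $y_i$ of $\|x-y_i\|^2-g_i^*$ wherever it is unique. For $i\ne j$ let $w_{ij}=\int_{\overline{T^{-1}(y_i)}\cap\overline{T^{-1}(y_j)}}p\,d\mathcal H_{d-1}$, and for $t,a\ge0$ let $$h_{ij}(t;a)=\int_{\{x\in S_i\,:\,\Delta_{ij}(x)=t,\ \Delta_{ik}(x)\ge a\ \forall k\ne i,j\}}p\,d\mathcal H_{d-1},\qquad h_{ij}(t)=h_{ij}(t;0),$$ where $\mathcal H_{d-1}$ is normalized to agree with Lebesgue measure on hyperplanes. Finally let $$\Phi(\eta)=\inf_{\delta\in\mathbb R^n,\ \sum_i q_i\delta_i=0}\ \sum_{i=1}^n\int_{S_i}\log\Big(1+\sum_{j\ne i}e^{\delta_j-\delta_i-\eta\Delta_{ij}(x)}\Big)\,d\mu(x).$$ **Hypotheses.** Assume (a) or (b): (a) $\mu$ has finite second moment, the interior of $\operatorname{supp}\mu$ is connected, the boundary of $\operatorname{supp}\mu$ is Lebesgue-null, and $p>0$ on the interior of $\operatorname{supp}\mu$; moreover, for all $i\ne j$ and all sufficiently small $a\ge0$,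 the functions $t\mapsto h_{ij}(t;a)$ and $a\mapsto h_{ij}(0;a)$ on $[0,\infty)$ are finite and continuous at $0$. (b) $\operatorname{supp}\mu$ is compact and connected; $p$ is bounded, vanishes off $\operatorname{supp}\mu$, and is positive and continuous on the interior of $\operatorname{supp}\mu$; and, for all $i\neq j$, $p$ is continuous at $\mathcal H_{d-1}$-almost every point of $S_i\cap S_j\cap\partial\operatorname{supp}\mu$ (this is automatic if $p$ is continuous on $\mathbb R^d$, or if these sets are $\mathcal H_{d-1}$-null). **Theorem.** All quantities below are finite and, as $\eta\to\infty$, $$\mathbb E_{\pi_\eta}\|x-y\|^2+\frac1\eta\mathrm{KL}(\pi_\eta\,\|\,\mu\otimes\nu)=W_2^2(\mu,\nu)+\frac{H(\nu)}{\eta}-\frac{\zeta(2)}{2\eta^2}\sum_{i<j}\frac{w_{ij}}{\|y_i-y_j\|}+o(\eta^{-2}),\qquad \zeta(2)=\frac{\pi^2}{6}.$$ Equivalently, $$\lim_{\eta\to\infty}\eta\,\Phi(\eta)=\frac{\zeta(2)}2\sum_{i<j}\frac{h_{ij}(0)}{\|y_i-y_j\|}.$$ -/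

import Mathlib

open MeasureTheory Filter Topology
open scoped ENNReal

noncomputable section

namespace SemiDiscrete

/-! ## Optimal transport and its entropic regularization -/

/-- The set `Π(μ, ν)` of couplings of `μ` and `ν`. -/
def couplings {E : Type*} [MeasurableSpace E] (μ ν : Measure E) : Set (Measure (E × E)) :=
  {γ | γ.fst = μ ∧ γ.snd = ν}

/-- The transport cost `E_γ ‖x - y‖²`, as an extended nonnegative number. -/
def transportCost {E : Type*} [NormedAddCommGroup E] [MeasurableSpace E]
    (γ : Measure (E × E)) : ℝ≥0∞ :=
  ∫⁻ z, ‖z.1 - z.2‖ₑ ^ 2 ∂γ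

/-- The squared Wasserstein distance `W₂²(μ, ν)`. -/
def wassersteinSq {E : Type*} [NormedAddCommGroup E] [MeasurableSpace E]
    (μ ν : Measure E) : ℝ≥0∞ :=
  ⨅ γ ∈ couplings μ ν, transportCost γ

/-- The entropic objective `E_γ ‖x - y‖² + η⁻¹ KL(γ ‖ μ ⊗ ν)`. -/
def entropicObjective {E : Type*} [NormedAddCommGroup E] [MeasurableSpace E]
    (μ ν : Measure E) (η : ℝ) (γ : Measure (E × E)) : ℝ≥0∞ :=
  transportCost γ + ENNReal.ofReal η⁻¹ * InformationTheory.klDiv γ (μ.prod ν)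

/-- `γ` is a solution of the entropic optimal transport problem with parameter `η`. -/
structure IsEntropicPlan {E : Type*} [NormedAddCommGroup E] [MeasurableSpace E]
    (μ ν : Measure E) (η : ℝ) (γ : Measure (E × E)) : Prop where
  mem_couplings : γ ∈ couplings μ ν
  isMin : ∀ γ' ∈ couplings μ ν, entropicObjective μ ν η γ ≤ entropicObjective μ ν η γ'

/-- `(f, g) ∈ L¹(μ) × L¹(ν)` is feasible for the dual of the (unregularized) optimal transport
problem: `f(x) + g(y) ≤ ‖x - y‖²`. The functions are classes in `L¹`, so that the constraint is
meant almost everywhere. -/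
structure IsDualFeasible {E : Type*} [NormedAddCommGroup E] [MeasurableSpace E]
    (μ ν : Measure E) (f g : E → ℝ) : Prop where
  integrable_left : Integrable f μ
  integrable_right : Integrable g ν
  le_cost : ∀ᵐ z ∂(μ.prod ν), f z.1 + g z.2 ≤ ‖z.1 - z.2‖ ^ 2

/-- `(f, g)` is a solution of the dual of the (unregularized) optimal transport problem, normalized
by `E_ν[g] = 0`. -/
structure IsOptimalPotentials {E : Type*} [NormedAddCommGroup E] [MeasurableSpace E]
    (μ ν : Measure E) (f g : E → ℝ) : Prop where
  feasible : IsDualFeasible μ ν f g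
  isMax : ∀ f' g' : E → ℝ, IsDualFeasible μ ν f' g' →
    ∫ x, f' x ∂μ + ∫ y, g' y ∂ν ≤ ∫ x, f x ∂μ + ∫ y, g y ∂ν
  normalized : ∫ y, g y ∂ν = 0

/-! ## Geometry of the power cells

`y i` are the atoms of `ν`, and `g i` is the value at `y i` of the optimal potential. -/

variable {d n : ℕ}

/-- The power cell `S_i`. -/
def powerCell (y : Fin n → EuclideanSpace ℝ (Fin d)) (g : Fin n → ℝ) (i : Fin n) :
    Set (EuclideanSpace ℝ (Fin d)) :=
  {x | ∀ j, ‖x - y i‖ ^ 2 - g i ≤ ‖x - y j‖ ^ 2 - g j}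

/-- The set `T⁻¹(y_i)` of the points sent to `y_i` by the optimal transport map
`T(x) = argmin_{y_j} (‖x - y_j‖² - g_j)`, which is defined where the minimizer is unique. -/
def mapFibre (y : Fin n → EuclideanSpace ℝ (Fin d)) (g : Fin n → ℝ) (i : Fin n) :
    Set (EuclideanSpace ℝ (Fin d)) :=
  {x | ∀ j, j ≠ i → ‖x - y i‖ ^ 2 - g i < ‖x - y j‖ ^ 2 - g j}

/-- The slack `Δ_ij(x) = ‖x - y_j‖² - f(x) - g_j`, where `f(x) = ‖x - y_i‖² - g_i` for `x ∈ S_i`. -/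
def slack (y : Fin n → EuclideanSpace ℝ (Fin d)) (g : Fin n → ℝ) (i j : Fin n)
    (x : EuclideanSpace ℝ (Fin d)) : ℝ :=
  ‖x - y j‖ ^ 2 - (‖x - y i‖ ^ 2 - g i) - g j

/-- The set `S_ij(a)`: the points of `S_i` with `Δ_ik ≥ a` for all `k ≠ i, j`. -/
def shrunkCell (y : Fin n → EuclideanSpace ℝ (Fin d)) (g : Fin n → ℝ) (i j : Fin n) (a : ℝ) :
    Set (EuclideanSpace ℝ (Fin d)) :=
  {x ∈ powerCell y g i | ∀ k, k ≠ i → k ≠ j → a ≤ slack y g i k x}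

/-- The slice `H_ij(t; a) = {x ∈ S_ij(a) : Δ_ij(x) = t}`. -/
def slice (y : Fin n → EuclideanSpace ℝ (Fin d)) (g : Fin n → ℝ) (i j : Fin n) (t a : ℝ) :
    Set (EuclideanSpace ℝ (Fin d)) :=
  {x ∈ shrunkCell y g i j a | slack y g i j x = t}

/-- The `(d - 1)`-dimensional integral of the density `p` on the set `A`, with respect to the
Hausdorff measure normalized to agree with Lebesgue measure on hyperplanes. -/
def surfaceIntegral (p : EuclideanSpace ℝ (Fin d) → ℝ) (A : Set (EuclideanSpace ℝ (Fin d))) :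
    ℝ≥0∞ :=
  ∫⁻ x in A, ENNReal.ofReal (p x) ∂(Measure.euclideanHausdorffMeasure (d - 1))

/-- The function `h_ij(t; a)`, the integral of the density on `H_ij(t; a)`. -/
def sliceMass (p : EuclideanSpace ℝ (Fin d) → ℝ) (y : Fin n → EuclideanSpace ℝ (Fin d))
    (g : Fin n → ℝ) (i j : Fin n) (t a : ℝ) : ℝ≥0∞ :=
  surfaceIntegral p (slice y g i j t a)

/-- The number `w_ij`, the integral of the density on the common boundary of `T⁻¹(y_i)` and
`T⁻¹(y_j)`. -/
def boundaryMass (p : EuclideanSpace ℝ (Fin d) → ℝ) (y : Fin n → EuclideanSpace ℝ (Fin d))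
    (g : Fin n → ℝ) (i j : Fin n) : ℝ≥0∞ :=
  surfaceIntegral p (closure (mapFibre y g i) ∩ closure (mapFibre y g j))

/-! ## Regularity of the source measure -/

/-- General conditions on `μ` and its density `p`: finite second moment; the support has connected
interior and Lebesgue-null boundary; the density is positive on the interior of the support. -/
structure RegularSupport (μ : Measure (EuclideanSpace ℝ (Fin d)))
    (p : EuclideanSpace ℝ (Fin d) → ℝ) : Prop where
  secondMoment : ∫⁻ x, ‖x‖ₑ ^ 2 ∂μ ≠ ∞
  connected : IsConnected (interior μ.support)
  null_frontier : volume (frontier μ.support) = 0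
  pos : ∀ x ∈ interior μ.support, 0 < p x

/-- For all small `a ≥ 0`, the functions `t ↦ h_ij(t; a)` and `a ↦ h_ij(0; a)`, defined for
`t, a ≥ 0`, are finite and continuous at `0`. -/
def SlicesContinuous (p : EuclideanSpace ℝ (Fin d) → ℝ) (y : Fin n → EuclideanSpace ℝ (Fin d))
    (g : Fin n → ℝ) : Prop :=
  ∀ i j, i ≠ j →
    (∀ᶠ a in 𝓝[≥] (0 : ℝ), sliceMass p y g i j 0 a ≠ ∞ ∧
      ContinuousWithinAt (fun t => sliceMass p y g i j t a) (Set.Ici 0) 0) ∧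
    ContinuousWithinAt (fun a => sliceMass p y g i j 0 a) (Set.Ici 0) 0

/-- Concrete conditions on `μ` and its density `p`: the support is compact and connected; the
density is bounded, is positive and continuous on the interior of the support, and vanishes off the
support; and it is continuous at almost every boundary point of the support (with respect to
`(d - 1)`-dimensional measure) at which two of the cells meet. The last condition holds when `p` is
continuous, and also when the interfaces of the cells meet the boundary of the support in null
sets. -/
structure RegularDensity (μ : Measure (EuclideanSpace ℝ (Fin d)))
    (p : EuclideanSpace ℝ (Fin d) → ℝ) (y : Fin n → EuclideanSpace ℝ (Fin d))
    (g : Fin n → ℝ) : Prop where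
  compact : IsCompact μ.support
  connected : IsConnected μ.support
  bounded : ∃ C : ℝ, ∀ x, p x ≤ C
  pos : ∀ x ∈ interior μ.support, 0 < p x
  continuous_interior : ∀ x ∈ interior μ.support, ContinuousAt p x
  eq_zero : ∀ x, x ∉ μ.support → p x = 0
  continuous_interface : ∀ i j, i ≠ j →
    ∀ᵐ x ∂((Measure.euclideanHausdorffMeasure (d - 1)).restrict
      (powerCell y g i ∩ powerCell y g j)), x ∈ frontier μ.support → ContinuousAt p x

/-! ## The expansion -/

/-- The Shannon entropy `-∑ q_i log q_i`. -/
def shannonEntropy (q : Fin n → ℝ) : ℝ := -∑ i, q i * Real.log (q i)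

/-- The objective of the auxiliary dual problem,
`∑_i ∫_{S_i} log (1 + ∑_{j ≠ i} exp (δ_j - δ_i - η Δ_ij(x))) dμ(x)`. -/
def auxObjective (μ : Measure (EuclideanSpace ℝ (Fin d))) (y : Fin n → EuclideanSpace ℝ (Fin d))
    (g : Fin n → ℝ) (η : ℝ) (δ : Fin n → ℝ) : ℝ :=
  ∑ i, ∫ x in powerCell y g i,
    Real.log (1 + ∑ j ∈ Finset.univ.erase i, Real.exp (δ j - δ i - η * slack y g i j x)) ∂μ

/-- The value `Φ(η)` of the auxiliary dual problem: the infimum of the objective over all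
`δ : {y_1, …, y_n} → ℝ` with `E_ν[δ] = 0`. -/
def auxValue (μ : Measure (EuclideanSpace ℝ (Fin d))) (y : Fin n → EuclideanSpace ℝ (Fin d))
    (q : Fin n → ℝ) (g : Fin n → ℝ) (η : ℝ) : ℝ :=
  ⨅ δ : {δ : Fin n → ℝ // ∑ i, q i * δ i = 0}, auxObjective μ y g η δ

end SemiDiscrete

end

/-! Entropic duality reduces the problem to finitely many unknowns. With the dual potential written
as `g + δ / η`, the entropic value is `(H(ν) - F(δ)) / η`, where `F` is the `μ`-integral of the
log-sum-exp of the scores `δ_j - η (‖x - y_j‖² - g_j)` and `δ` minimizes `F` subject to `∑ q_i δ_i =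
0`. On `S_i` the score without `δ` is largest at index `i`. Factoring it out, and using `μ(S_i) =
q_i` to kill the linear term, gives `F(δ) = auxObjective δ - η ∫ cTransform`. Hence the cost is
exactly `∫ cTransform + H(ν) / η - Φ(η) / η` (`IsEntropicPlan.cost_eq_auxValue`). Weak duality and
this same identity as `η → ∞` identify `∫ cTransform` with `W₂²`, so only the limit of `η Φ(η)`
remains (`tendsto_mul_auxValue`).

Upper bound: take `δ = 0` and use `log (1 + ∑ a_j) ≤ ∑ log (1 + a_j)`. The coarea formula turns each
term into `(2 ‖y_i - y_j‖)⁻¹ ∫ log (1 + exp (-η t)) h_ij(t) dt`, and `η log (1 + exp (-η t))`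
concentrates at `t = 0` with mass `ζ(2) / 2`.

Lower bound, uniform in `δ`: in the strip `Δ_ij < a`, with all other slacks at least `a`, keep only
the term `j`. For fixed `i` these strips are disjoint. The two sides of an interface see opposite
shifts `δ_j - δ_i` and `δ_i - δ_j`, so convexity of `u ↦ log (1 + exp u)` removes `δ`
(`le_ofReal_auxObjective`). Then `η → ∞`, and afterwards `a → 0`.

Under the concrete hypotheses, continuity of the slice masses follows by dominated convergence in
coordinates where `Δ_ij` is one variable. The point is that other interfaces meet the hyperplane
`Δ_ij = 0` in null sets, because every cell has positive mass and hence points of strict minimum. -/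

namespace SemiDiscrete

/-! ## The log-sum-exp function -/

section LogSumExp

variable {n : ℕ}

/-- The function `a ↦ log (∑ j, exp (a j))`. -/
noncomputable def logSumExp (a : Fin n → ℝ) : ℝ := Real.log (∑ j, Real.exp (a j))

lemma sum_exp_pos (i : Fin n) (a : Fin n → ℝ) : 0 < ∑ j, Real.exp (a j) :=
  Finset.sum_pos (fun _ _ => Real.exp_pos _) ⟨i, Finset.mem_univ i⟩

lemma le_logSumExp (a : Fin n → ℝ) (i : Fin n) : a i ≤ logSumExp a := by
  rw [logSumExp, Real.le_log_iff_exp_le (sum_exp_pos i a)]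
  exact Finset.single_le_sum (f := fun j => Real.exp (a j)) (fun _ _ => (Real.exp_pos _).le)
    (Finset.mem_univ i)

/-- Each exponential exceeds its counterpart by a factor of at most `exp ‖a - b‖` in the sup norm.
The index `i` only witnesses that the sum is not empty. -/
lemma logSumExp_le_add_norm (i : Fin n) (a b : Fin n → ℝ) :
    logSumExp a ≤ logSumExp b + ‖a - b‖ := by
  have h : ∑ j, Real.exp (a j) ≤ (∑ j, Real.exp (b j)) * Real.exp ‖a - b‖ := by
    rw [Finset.sum_mul]
    refine Finset.sum_le_sum fun j _ => ?_
    rw [← Real.exp_add, Real.exp_le_exp]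
    have := (le_abs_self _).trans (norm_le_pi_norm (a - b) j)
    simp only [Pi.sub_apply] at this
    linarith
  have h' := Real.log_le_log (sum_exp_pos i a) h
  rwa [Real.log_mul (sum_exp_pos i b).ne' (Real.exp_pos _).ne', Real.log_exp] at h'

lemma logSumExp_add_const (i : Fin n) (a : Fin n → ℝ) (c : ℝ) :
    logSumExp (fun j => a j + c) = logSumExp a + c := by
  simp_rw [logSumExp, Real.exp_add, ← Finset.sum_mul]
  rw [Real.log_mul (sum_exp_pos i a).ne' (Real.exp_pos _).ne', Real.log_exp]

/-- The increment is exactly `log (1 + P (exp t - 1))`, with `P` the softmax weight of `i`, and `log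
(1 + u) ≤ u`. This avoids differentiating under the integral in the first-order condition. -/
lemma logSumExp_perturb_le (a : Fin n → ℝ) (i : Fin n) (t : ℝ) :
    logSumExp (fun j => a j + if j = i then t else 0) ≤
      logSumExp a + Real.exp (a i - logSumExp a) * (Real.exp t - 1) := by
  have hS := sum_exp_pos i a
  have hexp : Real.exp (a i - logSumExp a) = Real.exp (a i) / ∑ j, Real.exp (a j) := by
    rw [Real.exp_sub, logSumExp, Real.exp_log hS]
  have hsum : ∑ j, Real.exp (a j + if j = i then t else 0) =
      (∑ j, Real.exp (a j)) * (1 + Real.exp (a i - logSumExp a) * (Real.exp t - 1)) := by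
    have h1 : ∀ j, Real.exp (a j + if j = i then t else 0) =
        Real.exp (a j) + if j = i then Real.exp (a i) * (Real.exp t - 1) else 0 := by
      intro j
      split_ifs with h
      · subst h; rw [Real.exp_add]; ring
      · simp
    simp_rw [h1, Finset.sum_add_distrib, Finset.sum_ite_eq', Finset.mem_univ, if_true, hexp]
    field_simp
  have hpos : 0 < 1 + Real.exp (a i - logSumExp a) * (Real.exp t - 1) := by
    have := sum_exp_pos i (fun j => a j + if j = i then t else 0)
    rw [hsum] at this
    exact (pos_iff_pos_of_mul_pos this).1 hS
  rw [logSumExp, hsum, Real.log_mul hS.ne' hpos.ne']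
  have := Real.log_le_sub_one_of_pos hpos
  change logSumExp a + _ ≤ _
  linarith

lemma logSumExp_eq (a : Fin n → ℝ) (i : Fin n) :
    logSumExp a = a i + Real.log (1 + ∑ j ∈ Finset.univ.erase i, Real.exp (a j - a i)) := by
  have h : ∑ j, Real.exp (a j) =
      Real.exp (a i) * (1 + ∑ j ∈ Finset.univ.erase i, Real.exp (a j - a i)) := by
    rw [mul_add, mul_one, Finset.mul_sum, ← Finset.add_sum_erase _ _ (Finset.mem_univ i)]
    congr 1
    refine Finset.sum_congr rfl fun j _ => ?_
    rw [← Real.exp_add]; congr 1; ring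
  have hpos : 0 < 1 + ∑ j ∈ Finset.univ.erase i, Real.exp (a j - a i) :=
    add_pos_of_pos_of_nonneg one_pos (Finset.sum_nonneg fun _ _ => (Real.exp_pos _).le)
  rw [logSumExp, h, Real.log_mul (Real.exp_pos _).ne' hpos.ne', Real.log_exp]

end LogSumExp

/-! ## The integral of `log (1 + exp (-u))` -/

section LogOnePlusExp

lemma lintegral_comp_mul_left {c : ℝ} (hc : 0 < c) (f : ℝ → ℝ≥0∞) :
    ∫⁻ u, f (c * u) = ENNReal.ofReal c⁻¹ * ∫⁻ u, f u := by
  have h := lintegral_map_equiv (μ := volume) f (Homeomorph.mulLeft₀ c hc.ne').toMeasurableEquiv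
  have h2 : Measure.map (⇑(Homeomorph.mulLeft₀ c hc.ne').toMeasurableEquiv) volume =
      ENNReal.ofReal c⁻¹ • volume := by
    have := Real.map_volume_mul_left hc.ne'
    rw [abs_of_pos (inv_pos.2 hc)] at this
    exact this
  rw [h2, lintegral_smul_measure] at h
  exact h.symm

lemma setLIntegral_Ioi_comp_mul_left {c : ℝ} (hc : 0 < c) (f : ℝ → ℝ≥0∞) :
    ∫⁻ u in Set.Ioi 0, f (c * u) = ENNReal.ofReal c⁻¹ * ∫⁻ u in Set.Ioi 0, f u := by
  rw [← lintegral_indicator measurableSet_Ioi, ← lintegral_indicator measurableSet_Ioi,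
    ← lintegral_comp_mul_left hc]
  refine lintegral_congr fun u => ?_
  simp [Set.indicator_apply, hc]

lemma lintegral_exp_neg_mul {c : ℝ} (hc : 0 < c) :
    ∫⁻ u in Set.Ioi 0, ENNReal.ofReal (Real.exp (-(c * u))) = ENNReal.ofReal c⁻¹ := by
  rw [setLIntegral_Ioi_comp_mul_left hc (fun u => ENNReal.ofReal (Real.exp (-u))),
    ← ofReal_integral_eq_lintegral_ofReal (integrableOn_exp_neg_Ioi 0)
      (ae_of_all _ fun _ => (Real.exp_pos _).le), integral_exp_neg_Ioi_zero]
  simp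

/-- Expand `-log (1 - exp (-u)) = ∑ exp (-k u) / k` over `k ≥ 1` and integrate termwise; the terms
become `1 / k²`. -/
lemma lintegral_neg_log_one_sub_exp :
    ∫⁻ u in Set.Ioi 0, ENNReal.ofReal (-Real.log (1 - Real.exp (-u))) =
      ENNReal.ofReal (riemannZeta 2).re := by
  have hz : HasSum (fun k : ℕ => 1 / ((k : ℝ) + 1) ^ 2) (riemannZeta 2).re := by
    have h := hasSum_zeta_two
    have : (riemannZeta 2).re = Real.pi ^ 2 / 6 := by
      rw [riemannZeta_two]
      rw [show ((Real.pi : ℂ) ^ 2 / 6) = ((Real.pi ^ 2 / 6 : ℝ) : ℂ) by push_cast; rfl,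
        Complex.ofReal_re]
    rw [this]
    -- The term of index `0` is `1 / 0 = 0`, so the shift loses nothing.
    rw [← hasSum_nat_add_iff' 1] at h
    simpa using h
  have hser : ∀ u ∈ Set.Ioi (0 : ℝ), ENNReal.ofReal (-Real.log (1 - Real.exp (-u))) =
      ∑' k : ℕ, ENNReal.ofReal (1 / ((k : ℝ) + 1)) *
        ENNReal.ofReal (Real.exp (-(((k : ℝ) + 1) * u))) := by
    intro u hu
    have hu : 0 < u := hu
    have h1 : |Real.exp (-u)| < 1 := by
      rw [abs_of_pos (Real.exp_pos _), Real.exp_lt_one_iff]; linarith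
    have h2 := Real.hasSum_pow_div_log_of_abs_lt_one h1
    rw [← h2.tsum_eq, ENNReal.ofReal_tsum_of_nonneg (fun k => by positivity) h2.summable]
    refine tsum_congr fun k => ?_
    rw [← ENNReal.ofReal_mul (by positivity), ← Real.exp_nat_mul]
    congr 1
    rw [div_mul_eq_mul_div, one_mul]
    congr 2
    push_cast; ring
  rw [setLIntegral_congr_fun measurableSet_Ioi hser, lintegral_tsum (fun k => by fun_prop)]
  have : ∀ k : ℕ, ∫⁻ u in Set.Ioi 0, ENNReal.ofReal (1 / ((k : ℝ) + 1)) *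
        ENNReal.ofReal (Real.exp (-(((k : ℝ) + 1) * u))) =
      ENNReal.ofReal (1 / ((k : ℝ) + 1) ^ 2) := by
    intro k
    rw [lintegral_const_mul _ (by fun_prop), lintegral_exp_neg_mul (by positivity),
      ← ENNReal.ofReal_mul (by positivity)]
    congr 1
    field_simp
  simp_rw [this]
  rw [← ENNReal.ofReal_tsum_of_nonneg (fun k => by positivity) hz.summable, hz.tsum_eq]

lemma re_riemannZeta_two_nonneg : 0 ≤ (riemannZeta 2).re := by
  rw [riemannZeta_two, show ((Real.pi : ℂ) ^ 2 / 6) = ((Real.pi ^ 2 / 6 : ℝ) : ℂ) by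
    push_cast; rfl, Complex.ofReal_re]
  positivity

/-- From `1 - exp (-2u) = (1 - exp (-u)) (1 + exp (-u))` and the substitution `u ↦ 2u` one gets `J =
A + J / 2`, and `J` is finite. -/
lemma lintegral_log_one_add_exp :
    ∫⁻ u in Set.Ioi 0, ENNReal.ofReal (Real.log (1 + Real.exp (-u))) =
      ENNReal.ofReal ((riemannZeta 2).re / 2) := by
  set J := ∫⁻ u in Set.Ioi 0, ENNReal.ofReal (-Real.log (1 - Real.exp (-u))) with hJ
  set A := ∫⁻ u in Set.Ioi 0, ENNReal.ofReal (Real.log (1 + Real.exp (-u))) with hA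
  have hfin : J ≠ ∞ := by rw [hJ, lintegral_neg_log_one_sub_exp]; exact ENNReal.ofReal_ne_top
  have key : J = A + ENNReal.ofReal 2⁻¹ * J := by
    rw [hJ, ← setLIntegral_Ioi_comp_mul_left two_pos, hA, ← lintegral_add_left (by fun_prop)]
    refine setLIntegral_congr_fun measurableSet_Ioi fun u hu => ?_
    have hu : 0 < u := hu
    have hlt : Real.exp (-u) < 1 := by rw [Real.exp_lt_one_iff]; linarith
    have hpos := Real.exp_pos (-u)
    have hsq : Real.exp (-(2 * u)) = Real.exp (-u) ^ 2 := by
      rw [← Real.exp_nat_mul]; congr 1; push_cast; ring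
    rw [hsq, ← ENNReal.ofReal_add (Real.log_nonneg (by linarith))
      (neg_nonneg.2 (Real.log_nonpos (by nlinarith) (by nlinarith)))]
    congr 1
    rw [show 1 - Real.exp (-u) ^ 2 = (1 - Real.exp (-u)) * (1 + Real.exp (-u)) by ring,
      Real.log_mul (by linarith) (by linarith)]
    ring
  have hAfin : A ≠ ∞ := by
    intro h; rw [h, top_add] at key; exact hfin key
  have hreal : J.toReal = A.toReal + 2⁻¹ * J.toReal := by
    conv_lhs => rw [key]
    rw [ENNReal.toReal_add hAfin (ENNReal.mul_ne_top ENNReal.ofReal_ne_top hfin),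
      ENNReal.toReal_mul, ENNReal.toReal_ofReal (by norm_num)]
  have hz : J = ENNReal.ofReal (riemannZeta 2).re := lintegral_neg_log_one_sub_exp
  rw [← ENNReal.ofReal_toReal hAfin]
  congr 1
  rw [hz, ENNReal.toReal_ofReal re_riemannZeta_two_nonneg] at hreal
  linarith

end LogOnePlusExp

/-! ## Concentration of `log (1 + exp (-η t))` at `t = 0` -/

lemma log_one_add_exp_nonneg (u : ℝ) : 0 ≤ Real.log (1 + Real.exp u) :=
  Real.log_nonneg (by linarith [Real.exp_pos u])

lemma log_one_add_exp_le (u : ℝ) : Real.log (1 + Real.exp u) ≤ Real.exp u := by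
  have := Real.log_le_sub_one_of_pos (x := 1 + Real.exp u) (by positivity)
  linarith

lemma setLIntegral_Ici_comp_mul_left {c : ℝ} (hc : 0 < c) (f : ℝ → ℝ≥0∞) :
    ENNReal.ofReal c * ∫⁻ u in Set.Ici 0, f (c * u) = ∫⁻ u in Set.Ici 0, f u := by
  rw [setLIntegral_congr Ioi_ae_eq_Ici.symm, setLIntegral_Ioi_comp_mul_left hc, ← mul_assoc,
    ← ENNReal.ofReal_mul hc.le, mul_inv_cancel₀ hc.ne', ENNReal.ofReal_one, one_mul]
  exact setLIntegral_congr Ioi_ae_eq_Ici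

/-- If `h` is right-continuous at `0` and integrable, then the integral of `h` against
`η log (1 + exp (-η t))` tends to `h 0 * ζ(2) / 2`. -/
lemma tendsto_lintegral_log_one_add_exp {h : ℝ → ℝ≥0∞} (hm : Measurable h) (h0 : h 0 ≠ ∞)
    (hc : ContinuousWithinAt h (Set.Ici 0) 0) (hint : ∫⁻ t in Set.Ici 0, h t ≠ ∞) :
    Tendsto (fun η : ℝ => ENNReal.ofReal η *
        ∫⁻ t in Set.Ici 0, ENNReal.ofReal (Real.log (1 + Real.exp (-(η * t)))) * h t)
      atTop (𝓝 (ENNReal.ofReal ((riemannZeta 2).re / 2) * h 0)) := by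
  set F : ℝ → ℝ≥0∞ := fun u => ENNReal.ofReal (Real.log (1 + Real.exp (-u))) with hF
  have hFm : Measurable F := by fun_prop
  have hFint : ∫⁻ u in Set.Ici 0, F u = ENNReal.ofReal ((riemannZeta 2).re / 2) := by
    rw [← setLIntegral_congr Ioi_ae_eq_Ici, hF, lintegral_log_one_add_exp]
  -- `h` is bounded near `0`
  obtain ⟨ε, hε, hbd⟩ : ∃ ε > 0, ∀ t, 0 ≤ t → t < ε → h t ≤ h 0 + 1 := by
    have : ∀ᶠ t in 𝓝[≥] (0 : ℝ), h t ≤ h 0 + 1 :=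
      (hc.eventually_lt_const (ENNReal.lt_add_right h0 one_ne_zero)).mono fun _ => le_of_lt
    obtain ⟨u, hu, hsub⟩ := (mem_nhdsGE_iff_exists_Ico_subset).1 this
    exact ⟨u, hu, fun t h1 h2 => hsub ⟨h1, h2⟩⟩
  have hsplit : ∀ η : ℝ, ENNReal.ofReal η * ∫⁻ t in Set.Ici 0, F (η * t) * h t =
      (ENNReal.ofReal η * ∫⁻ t in Set.Ici 0, F (η * t) * (Set.Iio ε).indicator h t) +
      ENNReal.ofReal η * ∫⁻ t in Set.Ici 0, F (η * t) * (Set.Ici ε).indicator h t := by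
    intro η
    rw [← mul_add, ← lintegral_add_left (show Measurable fun t => F (η * t) *
      (Set.Iio ε).indicator h t from
        (hFm.comp (measurable_const_mul η)).mul (hm.indicator measurableSet_Iio))]
    congr 1
    refine lintegral_congr fun t => ?_
    rw [← mul_add]
    congr 1
    by_cases ht : t < ε
    · simp [ht]
    · simp [ht, not_lt.1 ht]
  -- the part near `0`
  have hnear : Tendsto (fun η : ℝ => ENNReal.ofReal η *
      ∫⁻ t in Set.Ici 0, F (η * t) * (Set.Iio ε).indicator h t) atTop
      (𝓝 (∫⁻ u in Set.Ici 0, F u * h 0)) := by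
    -- Substituting `u = η t` fixes the kernel `F` and moves `η` into `h (u / η)`, which tends to `h
    -- 0`.
    have hcv : ∀ᶠ η : ℝ in atTop, ∫⁻ u in Set.Ici 0, F u * (Set.Iio ε).indicator h (u / η) =
        ENNReal.ofReal η * ∫⁻ t in Set.Ici 0, F (η * t) * (Set.Iio ε).indicator h t := by
      filter_upwards [eventually_gt_atTop 0] with η hη
      rw [← setLIntegral_Ici_comp_mul_left hη]
      congr 1
      refine lintegral_congr fun t => ?_
      rw [mul_div_cancel_left₀ _ hη.ne']
    refine Tendsto.congr' hcv ?_
    refine tendsto_lintegral_filter_of_dominated_convergence (fun u => F u * (h 0 + 1))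
      (Eventually.of_forall fun η => hFm.mul
        ((hm.indicator measurableSet_Iio).comp (measurable_id.div_const η))) ?_ ?_ ?_
    · filter_upwards [eventually_gt_atTop 0] with η hη
      refine (ae_restrict_iff' measurableSet_Ici).2 (ae_of_all _ fun u hu => ?_)
      gcongr
      by_cases ht : u / η < ε
      · simpa [ht] using hbd _ (div_nonneg hu hη.le) ht
      · simp [ht]
    · rw [lintegral_mul_const _ hFm, hFint]
      exact ENNReal.mul_ne_top ENNReal.ofReal_ne_top (ENNReal.add_ne_top.2 ⟨h0, ENNReal.one_ne_top⟩)
    · refine (ae_restrict_iff' measurableSet_Ici).2 (ae_of_all _ fun u hu => ?_)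
      refine ENNReal.Tendsto.const_mul ?_ (Or.inr ENNReal.ofReal_ne_top)
      have hdiv : Tendsto (fun η : ℝ => u / η) atTop (𝓝[≥] 0) :=
        tendsto_nhdsWithin_iff.2 ⟨tendsto_const_nhds.div_atTop tendsto_id,
          (eventually_gt_atTop 0).mono fun η hη => div_nonneg hu (le_of_lt hη)⟩
      refine (hc.tendsto.comp hdiv).congr' ?_
      have : ∀ᶠ η : ℝ in atTop, u / η < ε :=
        (tendsto_nhds_of_tendsto_nhdsWithin hdiv).eventually_lt_const hε
      filter_upwards [this] with η hη
      simp [hη]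
  -- the part away from `0`
  have hfar : Tendsto (fun η : ℝ => ENNReal.ofReal η *
      ∫⁻ t in Set.Ici 0, F (η * t) * (Set.Ici ε).indicator h t) atTop (𝓝 0) := by
    -- For `t ≥ ε` the kernel is at most `exp (-ε η)`, which beats the factor `η`.
    have hlim : Tendsto (fun η : ℝ => ENNReal.ofReal (η * Real.exp (-(ε * η))) *
        ∫⁻ t in Set.Ici 0, h t) atTop (𝓝 0) := by
      rw [← zero_mul (∫⁻ t in Set.Ici 0, h t)]
      refine ENNReal.Tendsto.mul_const ?_ (Or.inr hint)
      rw [← ENNReal.ofReal_zero]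
      refine ENNReal.tendsto_ofReal ?_
      have := (Real.tendsto_pow_mul_exp_neg_atTop_nhds_zero 1).comp
        (tendsto_id.const_mul_atTop hε)
      have h2 := this.const_mul ε⁻¹
      rw [mul_zero] at h2
      refine h2.congr fun η => ?_
      simp only [Function.comp_apply, id, pow_one]
      field_simp
    refine tendsto_of_tendsto_of_tendsto_of_le_of_le' tendsto_const_nhds hlim
      (Eventually.of_forall fun _ => zero_le) ?_
    filter_upwards [eventually_gt_atTop 0] with η hη
    rw [ENNReal.ofReal_mul hη.le, mul_assoc, ← lintegral_const_mul _ hm]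
    refine mul_le_mul_right (lintegral_mono fun t => ?_) _
    by_cases ht : ε ≤ t
    · rw [Set.indicator_of_mem (Set.mem_Ici.2 ht)]
      refine mul_le_mul_left (ENNReal.ofReal_le_ofReal ((log_one_add_exp_le _).trans ?_)) _
      rw [Real.exp_le_exp]
      nlinarith
    · rw [Set.indicator_of_notMem (by simpa using ht), mul_zero]
      exact zero_le
  have := hnear.add hfar
  rw [add_zero, lintegral_mul_const _ hFm, hFint] at this
  exact this.congr fun η => (hsplit η).symm

open scoped RealInnerProductSpace

/-! ## Slicing Euclidean space along the level sets of a slack -/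

section Chart

variable {m n : ℕ}

/-- Splitting off the direction of a unit vector preserves volume. -/
lemma exists_linearIsometry_orthogonal (u : EuclideanSpace ℝ (Fin (m + 1))) (hu : ‖u‖ = 1) :
    ∃ ι : EuclideanSpace ℝ (Fin m) →ₗᵢ[ℝ] EuclideanSpace ℝ (Fin (m + 1)),
      (∀ w, ⟪ι w, u⟫ = 0) ∧ (∀ x, ∃ (r : ℝ) (w : _), x = r • u + ι w) ∧
      ∀ F : EuclideanSpace ℝ (Fin (m + 1)) → ℝ≥0∞, Measurable F →
        ∫⁻ x, F x = ∫⁻ r : ℝ, ∫⁻ w, F (r • u + ι w) := by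
  have hort : Orthonormal ℝ (({0} : Set (Fin (m + 1))).domRestrict
      (fun _ : Fin (m + 1) => u)) := by
    rw [orthonormal_iff_ite]
    rintro ⟨i, hi⟩ ⟨j, hj⟩
    obtain rfl : i = 0 := hi
    obtain rfl : j = 0 := hj
    simp [hu]
  -- An orthonormal basis with `b 0 = u`; the isometry `ι` parametrizes the span of the remaining
  -- vectors.
  obtain ⟨b, hb⟩ := hort.exists_orthonormalBasis_extension_of_card_eq (by simp)
  have hb0 : b 0 = u := hb 0 rfl
  let ι₀ : EuclideanSpace ℝ (Fin m) →ₗ[ℝ] EuclideanSpace ℝ (Fin (m + 1)) :=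
    { toFun := fun w => WithLp.toLp 2 (Fin.cons 0 w.ofLp)
      map_add' := fun w z => by
        ext k; refine Fin.cases ?_ (fun k => ?_) k <;> simp
      map_smul' := fun c w => by
        ext k; refine Fin.cases ?_ (fun k => ?_) k <;> simp }
  have hι₀ : ∀ w, ‖ι₀ w‖ = ‖w‖ := fun w => by
    rw [EuclideanSpace.norm_eq, EuclideanSpace.norm_eq, Fin.sum_univ_succ]
    simp [ι₀]
  let ι₁ : EuclideanSpace ℝ (Fin m) →ₗᵢ[ℝ] EuclideanSpace ℝ (Fin (m + 1)) := ⟨ι₀, hι₀⟩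
  have hu' : b.repr u = WithLp.toLp 2 (Fin.cons 1 (fun _ => 0)) := by
    rw [← hb0, b.repr_self]
    ext k; refine Fin.cases ?_ (fun k => ?_) k <;> simp [Fin.succ_ne_zero]
  have hsplit : ∀ (r : ℝ) w, r • u + b.repr.symm (ι₁ w) =
      b.repr.symm (WithLp.toLp 2 (Fin.cons r w.ofLp)) := by
    intro r w
    rw [← b.repr.symm_apply_apply u, hu', ← map_smul, ← map_add]
    congr 1
    ext k; refine Fin.cases ?_ (fun k => ?_) k <;> simp [ι₁, ι₀]
  refine ⟨b.repr.symm.toLinearIsometry.comp ι₁, fun w => ?_, fun x => ?_, fun F hF => ?_⟩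
  · have : ⟪b.repr.symm (ι₁ w), u⟫ = ⟪ι₁ w, b.repr u⟫ := by
      rw [← b.repr.inner_map_map, b.repr.apply_symm_apply]
    change ⟪b.repr.symm (ι₁ w), u⟫ = 0
    rw [this, hu', PiLp.inner_apply, Fin.sum_univ_succ]
    simp [ι₁, ι₀]
  · refine ⟨b.repr x 0, WithLp.toLp 2 (fun k => b.repr x k.succ), ?_⟩
    refine Eq.trans ?_ (hsplit _ _).symm
    rw [LinearIsometryEquiv.eq_symm_apply]
    ext k; refine Fin.cases ?_ (fun k => ?_) k <;> simp
  · have h1 : MeasurePreserving (fun z : ℝ × EuclideanSpace ℝ (Fin m) =>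
        b.repr.symm (WithLp.toLp 2 (Fin.cons z.1 z.2.ofLp : Fin (m + 1) → ℝ)))
        (volume.prod volume) volume := by
      have hA := (MeasurePreserving.id (volume : Measure ℝ)).prod
        (PiLp.volume_preserving_ofLp (Fin m))
      have hB := (volume_preserving_piFinSuccAbove (fun _ : Fin (m + 1) => ℝ) 0).symm
      have hC := b.measurePreserving_repr_symm.comp
        ((PiLp.volume_preserving_toLp (Fin (m + 1))).comp (hB.comp hA))
      convert hC using 1
      funext z
      simp [MeasurableEquiv.piFinSuccAbove, Fin.insertNthEquiv]
    rw [← h1.lintegral_comp hF]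
    refine (lintegral_prod _ (hF.comp h1.measurable).aemeasurable).trans ?_
    refine lintegral_congr fun r => lintegral_congr fun w => ?_
    exact congrArg F (hsplit r w).symm

/-- The terms `‖x‖²` cancel, so a slack is affine with gradient `2 (y i - y j)`. Its norm is the
coarea factor. -/
lemma slack_eq_inner {d : ℕ} (y : Fin n → EuclideanSpace ℝ (Fin d)) (g : Fin n → ℝ) (i j : Fin n)
    (x : EuclideanSpace ℝ (Fin d)) :
    slack y g i j x = 2 * ⟪x, y i - y j⟫ + (‖y j‖ ^ 2 - ‖y i‖ ^ 2 + g i - g j) := by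
  rw [slack, norm_sub_sq_real, norm_sub_sq_real, inner_sub_right]
  ring

lemma slack_add {d : ℕ} (y : Fin n → EuclideanSpace ℝ (Fin d)) (g : Fin n → ℝ) (i j : Fin n)
    (x z : EuclideanSpace ℝ (Fin d)) :
    slack y g i j (x + z) = slack y g i j x + 2 * ⟪z, y i - y j⟫ := by
  rw [slack_eq_inner, slack_eq_inner, inner_add_left]
  ring

/-- `(t, w) ↦ c + t • v + ι w` parametrizes the space by the value `t` of the slack `Δ_ij` and
Euclidean coordinates `w` on its level sets. -/
structure IsSlackChart (y : Fin n → EuclideanSpace ℝ (Fin (m + 1))) (g : Fin n → ℝ) (i j : Fin n)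
    (c v : EuclideanSpace ℝ (Fin (m + 1)))
    (ι : EuclideanSpace ℝ (Fin m) →ₗᵢ[ℝ] EuclideanSpace ℝ (Fin (m + 1))) : Prop where
  slack_eq : ∀ t w, slack y g i j (c + t • v + ι w) = t
  exists_eq : ∀ x, ∃ w, x = c + slack y g i j x • v + ι w
  norm_le : ∀ (t : ℝ) w, ‖w‖ ≤ ‖c + t • v + ι w‖
  lintegral_eq : ∀ F : EuclideanSpace ℝ (Fin (m + 1)) → ℝ≥0∞, Measurable F →
    ∫⁻ x, F x = ENNReal.ofReal (1 / (2 * ‖y i - y j‖)) * ∫⁻ t : ℝ, ∫⁻ w, F (c + t • v + ι w)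

/-- In coordinates `x = r u + ι w`, with `u` the unit vector along `y i - y j` and `L` the distance,
the slack is `2 L r + κ`. Solving for `r` gives `c`, `v` and the Jacobian `1 / (2 L)`. -/
lemma exists_isSlackChart (y : Fin n → EuclideanSpace ℝ (Fin (m + 1))) (g : Fin n → ℝ)
    (i j : Fin n) (hij : y i ≠ y j) : ∃ c v ι, IsSlackChart y g i j c v ι := by
  have hL : 0 < ‖y i - y j‖ := norm_pos_iff.2 (sub_ne_zero.2 hij)
  set L := ‖y i - y j‖ with hLdef
  set u := L⁻¹ • (y i - y j) with hu
  have hu1 : ‖u‖ = 1 := by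
    rw [hu, norm_smul, norm_inv, Real.norm_of_nonneg hL.le, ← hLdef, inv_mul_cancel₀ hL.ne']
  have hyu : y i - y j = L • u := by rw [hu, smul_smul, mul_inv_cancel₀ hL.ne', one_smul]
  clear_value u
  obtain ⟨ι, hort, hsurj, hint⟩ := exists_linearIsometry_orthogonal u hu1
  set κ := ‖y j‖ ^ 2 - ‖y i‖ ^ 2 + g i - g j with hκ
  have huu : ⟪u, u⟫ = 1 := by rw [real_inner_self_eq_norm_sq, hu1]; norm_num
  have hslack : ∀ (r : ℝ) w, slack y g i j (r • u + ι w) = 2 * L * r + κ := by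
    intro r w
    rw [slack_eq_inner, hyu, inner_smul_right, inner_add_left, hort, inner_smul_left, huu, ← hκ]
    simp; ring
  have hpt : ∀ (t : ℝ) w, (-κ / (2 * L)) • u + t • ((1 / (2 * L)) • u) + ι w =
      ((1 / (2 * L)) * (t + -κ)) • u + ι w := by
    intro t w
    rw [smul_smul, ← add_smul]
    congr 2; ring
  refine ⟨(-κ / (2 * L)) • u, (1 / (2 * L)) • u, ι, ⟨fun t w => ?_, fun x => ?_, fun t w => ?_,
    fun F hF => ?_⟩⟩
  · rw [hpt, hslack]; field_simp; ring
  · obtain ⟨r, w, rfl⟩ := hsurj x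
    refine ⟨w, ?_⟩
    rw [hpt, hslack]
    congr 2; field_simp; ring
  -- The other summand is a multiple of `u`, orthogonal to `ι w`, so Pythagoras applies.
  · rw [hpt]
    refine le_of_sq_le_sq ?_ (norm_nonneg _)
    rw [norm_add_sq_real, real_inner_smul_left, real_inner_comm, hort, ι.norm_map]
    nlinarith [sq_nonneg ‖(1 / (2 * L) * (t + -κ)) • u‖]
  · simp_rw [hpt]
    rw [hint F hF, lintegral_add_right_eq_self
      (fun t : ℝ => ∫⁻ w, F ((1 / (2 * L) * t) • u + ι w)) (-κ),
      lintegral_comp_mul_left (by positivity) (fun t : ℝ => ∫⁻ w, F (t • u + ι w)), ← mul_assoc,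
      ← ENNReal.ofReal_mul (by positivity), mul_inv_cancel₀ (by positivity), ENNReal.ofReal_one,
      one_mul]

end Chart

/-! ## Power cells and slices -/

section Cells

variable {d n : ℕ} (y : Fin n → EuclideanSpace ℝ (Fin d)) (g : Fin n → ℝ)

lemma continuous_slack (i j : Fin n) : Continuous (slack y g i j) := by
  unfold slack; fun_prop

lemma mem_powerCell_iff {i : Fin n} {x : EuclideanSpace ℝ (Fin d)} :
    x ∈ powerCell y g i ↔ ∀ j, 0 ≤ slack y g i j x := by
  simp only [powerCell, slack, Set.mem_ofPred_eq]
  exact forall_congr' fun j => ⟨fun h => by linarith, fun h => by linarith⟩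

lemma mem_mapFibre_iff {i : Fin n} {x : EuclideanSpace ℝ (Fin d)} :
    x ∈ mapFibre y g i ↔ ∀ j, j ≠ i → 0 < slack y g i j x := by
  simp only [mapFibre, slack, Set.mem_ofPred_eq]
  exact forall₂_congr fun j _ => ⟨fun h => by linarith, fun h => by linarith⟩

lemma slack_self (i : Fin n) (x : EuclideanSpace ℝ (Fin d)) : slack y g i i x = 0 := by
  unfold slack; ring

lemma slack_sub_slack (i j k : Fin n) (x : EuclideanSpace ℝ (Fin d)) :
    slack y g i k x - slack y g i j x = slack y g j k x := by
  unfold slack; ring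

lemma mem_shrunkCell_iff {i j : Fin n} {a : ℝ} (ha : 0 ≤ a) {x : EuclideanSpace ℝ (Fin d)} :
    x ∈ shrunkCell y g i j a ↔
      0 ≤ slack y g i j x ∧ ∀ k, k ≠ i → k ≠ j → a ≤ slack y g i k x := by
  rw [shrunkCell, Set.mem_ofPred_eq, mem_powerCell_iff]
  refine ⟨fun h => ⟨h.1 j, h.2⟩, fun h => ⟨fun k => ?_, h.2⟩⟩
  by_cases hki : k = i
  · rw [hki, slack_self]
  · by_cases hkj : k = j
    · rw [hkj]; exact h.1
    · exact ha.trans (h.2 k hki hkj)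

lemma shrunkCell_subset (i j : Fin n) (a : ℝ) : shrunkCell y g i j a ⊆ powerCell y g i :=
  fun _ hx => hx.1

lemma shrunkCell_zero (i j : Fin n) : shrunkCell y g i j 0 = powerCell y g i := by
  ext x
  exact ⟨fun h => h.1, fun h => ⟨h, fun k _ _ => (mem_powerCell_iff y g).1 h k⟩⟩

lemma measurableSet_powerCell (i : Fin n) : MeasurableSet (powerCell y g i) := by
  have : powerCell y g i = ⋂ j, {x | 0 ≤ slack y g i j x} := by
    ext x; simp [mem_powerCell_iff]
  rw [this]
  exact MeasurableSet.iInter fun j =>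
    measurableSet_le measurable_const (continuous_slack y g i j).measurable

lemma measurableSet_shrunkCell (i j : Fin n) (a : ℝ) : MeasurableSet (shrunkCell y g i j a) := by
  have : shrunkCell y g i j a =
      powerCell y g i ∩ ⋂ k, ⋂ (_ : k ≠ i), ⋂ (_ : k ≠ j), {x | a ≤ slack y g i k x} := by
    ext x; simp [shrunkCell]
  rw [this]
  exact (measurableSet_powerCell y g i).inter <| MeasurableSet.iInter fun k =>
    MeasurableSet.iInter fun _ => MeasurableSet.iInter fun _ =>
      measurableSet_le measurable_const (continuous_slack y g i k).measurable

/-- Where `Δ_ij` vanishes, `Δ_ik = Δ_jk` for every `k`, so `i` and `j` are interchangeable. Hence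
the slice masses from the two sides of an interface agree at `t = 0`. -/
lemma slice_zero_subset (i j : Fin n) (a : ℝ) : slice y g i j 0 a ⊆ slice y g j i 0 a := by
  rintro x ⟨hx, h0⟩
  have hs : ∀ k, slack y g j k x = slack y g i k x := fun k => by
    rw [← slack_sub_slack y g i j k, h0, sub_zero]
  refine ⟨⟨?_, fun k hkj hki => ?_⟩, ?_⟩
  · rw [mem_powerCell_iff]
    exact fun k => (hs k).symm ▸ (mem_powerCell_iff y g).1 hx.1 k
  · rw [hs]; exact hx.2 k hki hkj
  · rw [hs, slack_self]

lemma slice_zero_comm (i j : Fin n) (a : ℝ) : slice y g i j 0 a = slice y g j i 0 a :=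
  (slice_zero_subset y g i j a).antisymm (slice_zero_subset y g j i a)

lemma sliceMass_zero_comm (p : EuclideanSpace ℝ (Fin d) → ℝ) (i j : Fin n) (a : ℝ) :
    sliceMass p y g i j 0 a = sliceMass p y g j i 0 a := by
  rw [sliceMass, slice_zero_comm, sliceMass]

lemma powerCell_inter_powerCell (i j : Fin n) :
    powerCell y g i ∩ powerCell y g j = slice y g i j 0 0 := by
  ext x
  rw [slice, shrunkCell_zero]
  refine ⟨fun h => ⟨h.1, le_antisymm ?_ ((mem_powerCell_iff y g).1 h.1 j)⟩, fun h => ⟨h.1, ?_⟩⟩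
  · have := (mem_powerCell_iff y g).1 h.2 i
    rw [← slack_sub_slack y g i j i, slack_self] at this
    linarith
  · have : x ∈ slice y g i j 0 0 := by rw [slice, shrunkCell_zero]; exact h
    exact (slice_zero_subset y g i j 0 this).1.1

/-- Distinct points exclude dimension `0`, where `d - 1` would truncate. -/
lemma exists_eq_add_one_of_ne {x z : EuclideanSpace ℝ (Fin d)} (h : x ≠ z) :
    ∃ m, d = m + 1 := by
  cases d with
  | zero => exact absurd (Subsingleton.elim x z) h
  | succ m => exact ⟨m, rfl⟩

end Cells

/-! ### Slice masses in chart coordinates -/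

section Slices

variable {m n : ℕ} {y : Fin n → EuclideanSpace ℝ (Fin (m + 1))} {g : Fin n → ℝ} {i j : Fin n}
  {c v : EuclideanSpace ℝ (Fin (m + 1))}
  {ι : EuclideanSpace ℝ (Fin m) →ₗᵢ[ℝ] EuclideanSpace ℝ (Fin (m + 1))}

namespace IsSlackChart

lemma continuous : Continuous (fun z : ℝ × EuclideanSpace ℝ (Fin m) => c + z.1 • v + ι z.2) := by
  have := ι.continuous
  fun_prop

lemma isometry (t : ℝ) : Isometry (fun w => c + t • v + ι w) :=
  (isometry_add_left (c + t • v)).comp ι.isometry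

lemma range_eq (h : IsSlackChart y g i j c v ι) (t : ℝ) :
    Set.range (fun w => c + t • v + ι w) = {x | slack y g i j x = t} := by
  ext x
  constructor
  · rintro ⟨w, rfl⟩; exact h.slack_eq t w
  · rintro rfl
    obtain ⟨w, hw⟩ := h.exists_eq x
    exact ⟨w, hw.symm⟩

/-- An isometry carries the normalized Hausdorff measure to its restriction to the range, and on the
coordinate space that measure is Lebesgue measure. -/
lemma map_volume (h : IsSlackChart y g i j c v ι) (t : ℝ) :
    Measure.map (fun w => c + t • v + ι w) volume =
      (Measure.euclideanHausdorffMeasure m).restrict {x | slack y g i j x = t} := by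
  rw [← h.range_eq t, ← (isometry (c := c) (v := v) (ι := ι) t).map_euclideanHausdorffMeasure,
    EuclideanSpace.euclideanHausdorffMeasure_eq_volume]

lemma sliceMass_eq (h : IsSlackChart y g i j c v ι) {p : EuclideanSpace ℝ (Fin (m + 1)) → ℝ}
    (hp : Measurable p) (t a : ℝ) :
    sliceMass p y g i j t a = ∫⁻ w, (shrunkCell y g i j a).indicator
      (fun x => ENNReal.ofReal (p x)) (c + t • v + ι w) := by
  have hm := measurableSet_shrunkCell y g i j a
  have hF : Measurable ((shrunkCell y g i j a).indicator (fun x => ENNReal.ofReal (p x))) :=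
    hp.ennreal_ofReal.indicator hm
  rw [← lintegral_map hF (isometry t).continuous.measurable, h.map_volume t, lintegral_indicator hm,
    Measure.restrict_restrict hm]
  rfl

lemma measurable_sliceMass (h : IsSlackChart y g i j c v ι)
    {p : EuclideanSpace ℝ (Fin (m + 1)) → ℝ} (hp : Measurable p) (a : ℝ) :
    Measurable (fun t => sliceMass p y g i j t a) := by
  simp_rw [h.sliceMass_eq hp]
  refine Measurable.lintegral_prod_right' (f := fun z : ℝ × EuclideanSpace ℝ (Fin m) =>
    (shrunkCell y g i j a).indicator (fun x => ENNReal.ofReal (p x)) (c + z.1 • v + ι z.2)) ?_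
  exact (hp.ennreal_ofReal.indicator (measurableSet_shrunkCell y g i j a)).comp
    continuous.measurable

end IsSlackChart

end Slices

/-! ### The coarea formula for slacks -/

section Coarea

variable {d n : ℕ} {y : Fin n → EuclideanSpace ℝ (Fin d)} {g : Fin n → ℝ} {i j : Fin n}
  {p : EuclideanSpace ℝ (Fin d) → ℝ}

lemma measurable_sliceMass (hij : y i ≠ y j) (hp : Measurable p) (a : ℝ) :
    Measurable (fun t => sliceMass p y g i j t a) := by
  obtain ⟨m, rfl⟩ := exists_eq_add_one_of_ne hij
  obtain ⟨c, v, ι, h⟩ := exists_isSlackChart y g i j hij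
  exact h.measurable_sliceMass hp a

/-- The coarea formula for the function `Δ_ij` on `S_ij(a)`. -/
lemma lintegral_shrunkCell (hij : y i ≠ y j) (hp : Measurable p) {φ : ℝ → ℝ≥0∞}
    (hφ : Measurable φ) (a : ℝ) :
    ∫⁻ x in shrunkCell y g i j a, φ (slack y g i j x)
        ∂(volume.withDensity fun x => ENNReal.ofReal (p x)) =
      ENNReal.ofReal (1 / (2 * ‖y i - y j‖)) *
        ∫⁻ t in Set.Ici 0, φ t * sliceMass p y g i j t a := by
  obtain ⟨m, rfl⟩ := exists_eq_add_one_of_ne hij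
  obtain ⟨c, v, ι, h⟩ := exists_isSlackChart y g i j hij
  have hm := measurableSet_shrunkCell y g i j a
  have hφs : Measurable fun x => φ (slack y g i j x) :=
    hφ.comp (continuous_slack y g i j).measurable
  have hind : Measurable ((shrunkCell y g i j a).indicator (fun x => ENNReal.ofReal (p x))) :=
    hp.ennreal_ofReal.indicator hm
  rw [setLIntegral_withDensity_eq_setLIntegral_mul _ hp.ennreal_ofReal hφs hm,
    ← lintegral_indicator hm, h.lintegral_eq _ ((hp.ennreal_ofReal.mul hφs).indicator hm),
    ← lintegral_indicator measurableSet_Ici]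
  congr 1
  refine lintegral_congr fun t => ?_
  have h1 : ∀ w, (shrunkCell y g i j a).indicator
      ((fun x => ENNReal.ofReal (p x)) * fun x => φ (slack y g i j x)) (c + t • v + ι w) =
      φ t * (shrunkCell y g i j a).indicator (fun x => ENNReal.ofReal (p x)) (c + t • v + ι w) := by
    intro w
    by_cases hw : c + t • v + ι w ∈ shrunkCell y g i j a
    · simp only [hw, Set.indicator_of_mem, Pi.mul_apply, h.slack_eq]
      rw [mul_comm]
    · simp [hw]
  simp_rw [h1]
  have hmeas : Measurable fun w => (shrunkCell y g i j a).indicator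
      (fun x => ENNReal.ofReal (p x)) (c + t • v + ι w) :=
    hind.comp (IsSlackChart.isometry t).continuous.measurable
  rw [lintegral_const_mul _ hmeas, ← h.sliceMass_eq hp]
  by_cases ht : 0 ≤ t
  · simp [ht]
  · rw [Set.indicator_of_notMem (by simpa using ht)]
    -- Slacks are nonnegative on the cell, so negative levels contribute nothing.
    have : slice y g i j t a = ∅ := by
      refine Set.eq_empty_of_forall_notMem fun x hx => ht ?_
      rw [← hx.2]
      exact (mem_powerCell_iff y g).1 hx.1.1 j
    simp [sliceMass, surfaceIntegral, this]

end Coarea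

/-! ## Elementary inequalities -/

lemma log_one_add_sum_le {ι : Type*} (s : Finset ι) (a : ι → ℝ) (ha : ∀ j ∈ s, 0 ≤ a j) :
    Real.log (1 + ∑ j ∈ s, a j) ≤ ∑ j ∈ s, Real.log (1 + a j) := by
  classical
  rw [← Real.log_prod (fun j hj => by linarith [ha j hj])]
  refine Real.log_le_log (by linarith [Finset.sum_nonneg ha]) ?_
  induction s using Finset.induction_on with
  | empty => simp
  | insert k s hk ih =>
    have hs : ∀ j ∈ s, 0 ≤ a j := fun j hj => ha j (Finset.mem_insert_of_mem hj)
    rw [Finset.sum_insert hk, Finset.prod_insert hk]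
    nlinarith [ih hs, Finset.sum_nonneg hs, ha k (Finset.mem_insert_self k s)]

/-- Midpoint convexity of `u ↦ log (1 + exp u)`: the product of the two arguments on the right is `1
+ 2 exp u cosh b + exp (2u)`, at least `(1 + exp u)²`. This is why no `δ` does better than `0` to
leading order. -/
lemma two_mul_log_one_add_exp_le (b u : ℝ) :
    2 * Real.log (1 + Real.exp u) ≤
      Real.log (1 + Real.exp (b + u)) + Real.log (1 + Real.exp (-b + u)) := by
  rw [← Real.log_mul (by positivity) (by positivity), ← Nat.cast_two, ← Real.log_pow]
  refine Real.log_le_log (by positivity) ?_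
  have h1 : Real.exp (b + u) * Real.exp (-b + u) = Real.exp u * Real.exp u := by
    rw [← Real.exp_add, ← Real.exp_add]; congr 1; ring
  have h2 : 2 * Real.exp u ≤ Real.exp (b + u) + Real.exp (-b + u) := by
    have h3 : Real.exp (b + u) + Real.exp (-b + u) = Real.exp u * (2 * Real.cosh b) := by
      rw [Real.exp_add, Real.exp_add, Real.cosh_eq]; ring
    rw [h3]
    nlinarith [Real.one_le_cosh b, Real.exp_pos u]
  nlinarith

lemma sum_indicator_le {α ι : Type*} {s : Finset ι} {A : ι → Set α} {f : ι → α → ℝ≥0∞} {x : α}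
    {G : ℝ≥0∞} (hf : ∀ j ∈ s, f j x ≤ G)
    (hA : ∀ j ∈ s, ∀ k ∈ s, x ∈ A j → x ∈ A k → j = k) :
    ∑ j ∈ s, (A j).indicator (f j) x ≤ G := by
  by_cases h : ∃ j ∈ s, x ∈ A j
  · obtain ⟨j, hj, hx⟩ := h
    rw [Finset.sum_eq_single_of_mem j hj fun k hk hkj =>
      Set.indicator_of_notMem (fun hxk => hkj (hA k hk j hj hxk hx)) _, Set.indicator_of_mem hx]
    exact hf j hj
  · rw [Finset.sum_eq_zero fun j hj =>
      Set.indicator_of_notMem (fun hx => h ⟨j, hj, hx⟩) _]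
    exact zero_le

lemma sum_sum_erase_comm {n : ℕ} {M : Type*} [AddCommMonoid M] (T : Fin n → Fin n → M) :
    ∑ i, ∑ j ∈ Finset.univ.erase i, T i j = ∑ i, ∑ j ∈ Finset.univ.erase i, T j i :=
  Finset.sum_comm' (by simp [ne_comm])

/-! ## Bounds for the auxiliary objective -/

section Aux

variable {d n : ℕ} {μ : Measure (EuclideanSpace ℝ (Fin d))}
  {y : Fin n → EuclideanSpace ℝ (Fin d)} {g : Fin n → ℝ} {η : ℝ}

lemma one_le_one_add_sum_exp (s : Finset (Fin n)) (a : Fin n → ℝ) :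
    1 ≤ 1 + ∑ j ∈ s, Real.exp (a j) := by
  linarith [Finset.sum_nonneg fun j (_ : j ∈ s) => (Real.exp_pos (a j)).le]

lemma continuous_auxIntegrand (i : Fin n) (δ : Fin n → ℝ) :
    Continuous fun x => Real.log
      (1 + ∑ j ∈ Finset.univ.erase i, Real.exp (δ j - δ i - η * slack y g i j x)) := by
  have := continuous_slack y g
  refine Continuous.log (by fun_prop) fun x => ?_
  linarith [one_le_one_add_sum_exp (Finset.univ.erase i)
    (fun j => δ j - δ i - η * slack y g i j x)]

lemma auxIntegrand_nonneg (i : Fin n) (δ : Fin n → ℝ) (x : EuclideanSpace ℝ (Fin d)) :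
    0 ≤ Real.log (1 + ∑ j ∈ Finset.univ.erase i, Real.exp (δ j - δ i - η * slack y g i j x)) :=
  Real.log_nonneg (one_le_one_add_sum_exp _ _)

lemma auxObjective_nonneg (η : ℝ) (δ : Fin n → ℝ) : 0 ≤ auxObjective μ y g η δ :=
  Finset.sum_nonneg fun i _ => integral_nonneg fun x => auxIntegrand_nonneg i δ x

variable [IsProbabilityMeasure μ]

/-- On the cell the slacks are nonnegative, so the integrand is bounded by its value with all slacks
set to `0`. -/
lemma integrableOn_auxIntegrand (hη : 0 ≤ η) (i : Fin n) (δ : Fin n → ℝ) :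
    IntegrableOn (fun x => Real.log
      (1 + ∑ j ∈ Finset.univ.erase i, Real.exp (δ j - δ i - η * slack y g i j x)))
      (powerCell y g i) μ := by
  refine Measure.integrableOn_of_bounded (M := Real.log
    (1 + ∑ j ∈ Finset.univ.erase i, Real.exp (δ j - δ i))) (measure_ne_top _ _)
    (continuous_auxIntegrand i δ).aestronglyMeasurable ?_
  refine (ae_restrict_iff' (measurableSet_powerCell y g i)).2 (ae_of_all _ fun x hx => ?_)
  have h1 := one_le_one_add_sum_exp (Finset.univ.erase i)
    (fun j => δ j - δ i - η * slack y g i j x)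
  rw [Real.norm_of_nonneg (Real.log_nonneg h1)]
  refine Real.log_le_log (by linarith) ?_
  gcongr (1 + ∑ j ∈ _, Real.exp ?_) with j hj
  exact sub_le_self _ (mul_nonneg hη ((mem_powerCell_iff y g).1 hx j))

lemma ofReal_auxObjective (hη : 0 ≤ η) (δ : Fin n → ℝ) :
    ENNReal.ofReal (auxObjective μ y g η δ) =
      ∑ i, ∫⁻ x in powerCell y g i, ENNReal.ofReal (Real.log
        (1 + ∑ j ∈ Finset.univ.erase i, Real.exp (δ j - δ i - η * slack y g i j x))) ∂μ := by
  rw [auxObjective, ENNReal.ofReal_sum_of_nonneg fun i _ =>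
    integral_nonneg fun x => auxIntegrand_nonneg i δ x]
  refine Finset.sum_congr rfl fun i _ => ?_
  exact ofReal_integral_eq_lintegral_ofReal (integrableOn_auxIntegrand hη i δ)
    (ae_of_all _ fun x => auxIntegrand_nonneg i δ x)

variable {p : EuclideanSpace ℝ (Fin d) → ℝ}

/-- The coarea formula with `φ = 1` identifies this integral, up to a positive factor, with a
`μ`-mass. -/
lemma lintegral_sliceMass_ne_top (hp : Measurable p)
    (hμ : μ = volume.withDensity (fun x => ENNReal.ofReal (p x))) {i j : Fin n}
    (hij : y i ≠ y j) (a : ℝ) : ∫⁻ t in Set.Ici 0, sliceMass p y g i j t a ≠ ∞ := by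
  have h := lintegral_shrunkCell (g := g) hij hp (φ := fun _ => 1) measurable_const a
  rw [← hμ] at h
  simp only [lintegral_const, MeasurableSet.univ, Measure.restrict_apply, Set.univ_inter,
    one_mul] at h
  intro htop
  rw [htop, ENNReal.mul_top] at h
  · exact measure_ne_top _ _ h
  · have := norm_pos_iff.2 (sub_ne_zero.2 hij)
    simpa using this.ne'

/-- The upper bound given by the candidate `δ = 0`. -/
lemma ofReal_auxObjective_zero_le (hy : Function.Injective y) (hp : Measurable p)
    (hμ : μ = volume.withDensity (fun x => ENNReal.ofReal (p x))) (hη : 0 ≤ η) :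
    ENNReal.ofReal (auxObjective μ y g η 0) ≤
      ∑ i, ∑ j ∈ Finset.univ.erase i, ENNReal.ofReal (1 / (2 * ‖y i - y j‖)) *
        ∫⁻ t in Set.Ici 0, ENNReal.ofReal (Real.log (1 + Real.exp (-(η * t)))) *
          sliceMass p y g i j t 0 := by
  rw [ofReal_auxObjective hη]
  refine Finset.sum_le_sum fun i _ => ?_
  have hco : ∀ j ∈ Finset.univ.erase i, ENNReal.ofReal (1 / (2 * ‖y i - y j‖)) *
        ∫⁻ t in Set.Ici 0, ENNReal.ofReal (Real.log (1 + Real.exp (-(η * t)))) *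
          sliceMass p y g i j t 0 = ∫⁻ x in powerCell y g i,
            ENNReal.ofReal (Real.log (1 + Real.exp (-(η * slack y g i j x)))) ∂μ := by
    intro j hj
    rw [hμ, ← shrunkCell_zero y g i j, lintegral_shrunkCell
      (hy.ne (Finset.ne_of_mem_erase hj).symm) hp
      (φ := fun t => ENNReal.ofReal (Real.log (1 + Real.exp (-(η * t))))) (by fun_prop) 0]
  have hs := continuous_slack y g
  rw [Finset.sum_congr rfl hco, ← lintegral_finsetSum _ (fun j _ => by
    have := (hs i j).measurable
    fun_prop)]
  refine lintegral_mono fun x => ?_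
  rw [← ENNReal.ofReal_sum_of_nonneg fun j _ => log_one_add_exp_nonneg _]
  refine ENNReal.ofReal_le_ofReal ?_
  simpa using log_one_add_sum_le (Finset.univ.erase i)
    (fun j => Real.exp (-(η * slack y g i j x))) (fun j _ => (Real.exp_pos _).le)

/-- The lower bound obtained by keeping, near the interface of each pair of cells, only the
contribution of this pair. -/
lemma le_ofReal_auxObjective (hy : Function.Injective y) (hp : Measurable p)
    (hμ : μ = volume.withDensity (fun x => ENNReal.ofReal (p x))) (hη : 0 ≤ η) (a : ℝ)
    (δ : Fin n → ℝ) :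
    ∑ i, ∑ j ∈ Finset.univ.erase i, ENNReal.ofReal (1 / (2 * ‖y i - y j‖)) *
        ∫⁻ t in Set.Ici 0, ENNReal.ofReal (Real.log (1 + Real.exp (-(η * t)))) *
          (Set.Iio a).indicator
            (fun t => min (sliceMass p y g i j t a) (sliceMass p y g j i t a)) t ≤
      ENNReal.ofReal (auxObjective μ y g η δ) := by
  -- The minimum makes the weight symmetric in `i` and `j` and admissible on both sides of the
  -- interface, so that the two contributions can be paired.
  set M : Fin n → Fin n → ℝ → ℝ≥0∞ := fun i j => (Set.Iio a).indicator
    (fun t => min (sliceMass p y g i j t a) (sliceMass p y g j i t a)) with hM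
  have hMcomm : ∀ i j, M i j = M j i := fun i j => by simp only [hM, min_comm]
  have hMm : ∀ i j, i ≠ j → Measurable (M i j) := fun i j hij =>
    ((measurable_sliceMass (hy.ne hij) hp a).min
      (measurable_sliceMass (hy.ne hij.symm) hp a)).indicator measurableSet_Iio
  set T : ℝ → Fin n → Fin n → ℝ≥0∞ := fun b i j => ENNReal.ofReal (1 / (2 * ‖y i - y j‖)) *
    ∫⁻ t in Set.Ici 0, ENNReal.ofReal (Real.log (1 + Real.exp (b - η * t))) * M i j t with hT
  have hs := continuous_slack y g
  -- the bound for each cell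
  have hcell : ∀ i, ∑ j ∈ Finset.univ.erase i, T (δ j - δ i) i j ≤
      ∫⁻ x in powerCell y g i, ENNReal.ofReal (Real.log
        (1 + ∑ j ∈ Finset.univ.erase i, Real.exp (δ j - δ i - η * slack y g i j x))) ∂μ := by
    intro i
    set φ : Fin n → ℝ → ℝ≥0∞ := fun j => (Set.Iio a).indicator
      fun t => ENNReal.ofReal (Real.log (1 + Real.exp (δ j - δ i - η * t))) with hφ
    have hφm : ∀ j, Measurable (φ j) := fun j =>
      Measurable.indicator (by fun_prop) measurableSet_Iio
    have h1 : ∀ j ∈ Finset.univ.erase i, T (δ j - δ i) i j ≤ ∫⁻ x in powerCell y g i,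
        (shrunkCell y g i j a).indicator (fun x => φ j (slack y g i j x)) x ∂μ := by
      intro j hj
      have hij : y i ≠ y j := hy.ne (Finset.ne_of_mem_erase hj).symm
      rw [lintegral_indicator (measurableSet_shrunkCell y g i j a),
        Measure.restrict_restrict (measurableSet_shrunkCell y g i j a),
        Set.inter_eq_left.2 (shrunkCell_subset y g i j a), hμ,
        lintegral_shrunkCell hij hp (hφm j) a]
      refine mul_le_mul_right (lintegral_mono fun t => ?_) _
      by_cases ht : t < a
      · simp only [hφ, hM, Set.indicator_of_mem (Set.mem_Iio.2 ht)]
        exact mul_le_mul_right (min_le_left _ _) _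
      · simp only [hM, Set.indicator_of_notMem (show t ∉ Set.Iio a from ht), mul_zero]
        exact zero_le
    refine (Finset.sum_le_sum h1).trans ?_
    have hφs : ∀ j, Measurable ((shrunkCell y g i j a).indicator
        (fun x => φ j (slack y g i j x))) := fun j =>
      ((hφm j).comp (hs i j).measurable).indicator (measurableSet_shrunkCell y g i j a)
    rw [← lintegral_finsetSum _ (fun j _ => hφs j)]
    refine lintegral_mono fun x => ?_
    have h2 : ∀ j, (shrunkCell y g i j a).indicator (fun x => φ j (slack y g i j x)) x =
        (shrunkCell y g i j a ∩ {x | slack y g i j x < a}).indicator (fun x =>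
          ENNReal.ofReal (Real.log (1 + Real.exp (δ j - δ i - η * slack y g i j x)))) x := by
      intro j
      by_cases h3 : x ∈ shrunkCell y g i j a <;> by_cases h4 : slack y g i j x < a <;>
        simp [hφ, h3, h4]
    simp_rw [h2]
    refine sum_indicator_le (fun j hj => ENNReal.ofReal_le_ofReal ?_) ?_
    · refine Real.log_le_log (by positivity) ?_
      gcongr
      exact Finset.single_le_sum (f := fun j => Real.exp (δ j - δ i - η * slack y g i j x))
        (fun _ _ => (Real.exp_pos _).le) hj
    -- A point lies in at most one strip: the strip of `j` requires `Δ_ij < a`, that of any other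
    -- `k` requires `Δ_ij ≥ a`.
    · rintro j hj k hk ⟨hj1, hj2⟩ ⟨hk1, -⟩
      by_contra hjk
      exact absurd (hk1.2 j (Finset.ne_of_mem_erase hj) hjk) (not_le.2 hj2)
  rw [ofReal_auxObjective hη]
  refine le_trans ?_ (Finset.sum_le_sum fun i _ => hcell i)
  -- pair the contributions of the two sides of each interface
  have hpair : ∀ i, ∀ j ∈ Finset.univ.erase i,
      2 * T 0 i j ≤ T (δ j - δ i) i j + T (δ i - δ j) j i := by
    intro i j hj
    have hij : i ≠ j := (Finset.ne_of_mem_erase hj).symm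
    have hMij := hMm i j hij
    simp only [hT, hMcomm j i, norm_sub_rev (y j) (y i)]
    rw [mul_left_comm, ← mul_add, ← lintegral_add_left (by fun_prop),
      ← lintegral_const_mul _ (by fun_prop)]
    refine mul_le_mul_right (lintegral_mono fun t => ?_) _
    rw [← mul_assoc, ← add_mul]
    refine mul_le_mul_left ?_ _
    rw [← ENNReal.ofReal_add (log_one_add_exp_nonneg _) (log_one_add_exp_nonneg _),
      ← ENNReal.ofReal_ofNat 2, ← ENNReal.ofReal_mul (by norm_num)]
    refine ENNReal.ofReal_le_ofReal ?_
    convert two_mul_log_one_add_exp_le (δ j - δ i) (0 - η * t) using 4 <;> ring_nf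
  have hsum : 2 * ∑ i, ∑ j ∈ Finset.univ.erase i, T 0 i j ≤
      2 * ∑ i, ∑ j ∈ Finset.univ.erase i, T (δ j - δ i) i j := by
    -- Swapping the indices in one copy puts each ordered pair next to its reverse.
    conv_rhs => rw [two_mul]; arg 2; rw [sum_sum_erase_comm]
    rw [← Finset.sum_add_distrib, Finset.mul_sum]
    refine Finset.sum_le_sum fun i _ => ?_
    rw [← Finset.sum_add_distrib, Finset.mul_sum]
    exact Finset.sum_le_sum (hpair i)
  have := (ENNReal.mul_le_mul_iff_right two_ne_zero ENNReal.ofNat_ne_top).1 hsum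
  simpa only [hT, zero_sub] using this

end Aux

/-! ## The limit of the value of the auxiliary problem -/

section Limit

variable {d n : ℕ} {μ : Measure (EuclideanSpace ℝ (Fin d))}
  {y : Fin n → EuclideanSpace ℝ (Fin d)} {q : Fin n → ℝ} {g : Fin n → ℝ}
  {p : EuclideanSpace ℝ (Fin d) → ℝ}

lemma auxValue_le (η : ℝ) {δ : Fin n → ℝ} (hδ : ∑ i, q i * δ i = 0) :
    auxValue μ y q g η ≤ auxObjective μ y g η δ := by
  have hbdd : BddBelow (Set.range fun δ : {δ : Fin n → ℝ // ∑ i, q i * δ i = 0} =>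
      auxObjective μ y g η δ) :=
    ⟨0, Set.forall_mem_range.2 fun δ => auxObjective_nonneg η δ.1⟩
  exact ciInf_le hbdd ⟨δ, hδ⟩

lemma le_auxValue {η c : ℝ} (h : ∀ δ : Fin n → ℝ, ∑ i, q i * δ i = 0 → c ≤ auxObjective μ y g η δ) :
    c ≤ auxValue μ y q g η :=
  haveI : Nonempty {δ : Fin n → ℝ // ∑ i, q i * δ i = 0} := ⟨0, by simp⟩
  le_ciInf fun δ => h δ δ.2

lemma auxValue_nonneg (η : ℝ) : 0 ≤ auxValue μ y q g η :=
  le_auxValue fun δ _ => auxObjective_nonneg η δ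

/-- The limit of `η` times a sum over pairs of cells of integrals of `log (1 + exp (-η t))`. -/
lemma tendsto_mul_sum_lintegral (C : Fin n → Fin n → ℝ) {h : Fin n → Fin n → ℝ → ℝ≥0∞}
    (hm : ∀ i j, i ≠ j → Measurable (h i j)) (h0 : ∀ i j, i ≠ j → h i j 0 ≠ ∞)
    (hc : ∀ i j, i ≠ j → ContinuousWithinAt (h i j) (Set.Ici 0) 0)
    (hint : ∀ i j, i ≠ j → ∫⁻ t in Set.Ici 0, h i j t ≠ ∞) :
    Tendsto (fun η : ℝ => ENNReal.ofReal η * ∑ i, ∑ j ∈ Finset.univ.erase i,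
        ENNReal.ofReal (C i j) *
          ∫⁻ t in Set.Ici 0, ENNReal.ofReal (Real.log (1 + Real.exp (-(η * t)))) * h i j t)
      atTop (𝓝 (∑ i, ∑ j ∈ Finset.univ.erase i,
        ENNReal.ofReal (C i j) * (ENNReal.ofReal ((riemannZeta 2).re / 2) * h i j 0))) := by
  simp_rw [Finset.mul_sum, mul_left_comm (ENNReal.ofReal _) (ENNReal.ofReal (C _ _))]
  refine tendsto_finsetSum _ fun i _ => tendsto_finsetSum _ fun j hj => ?_
  have hij : i ≠ j := (Finset.ne_of_mem_erase hj).symm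
  exact ENNReal.Tendsto.const_mul (tendsto_lintegral_log_one_add_exp (hm i j hij) (h0 i j hij)
    (hc i j hij) (hint i j hij)) (Or.inr ENNReal.ofReal_ne_top)

/-- The candidate `δ = 0` bounds the limit above by `Λ 0`; the strips of width `a` bound it below by
`Λ a`, and `Λ a → Λ 0`. -/
theorem tendsto_mul_auxValue [IsProbabilityMeasure μ] (hy : Function.Injective y) (hp : Measurable p)
    (hμ : μ = volume.withDensity (fun x => ENNReal.ofReal (p x)))
    (hs : SlicesContinuous p y g) :
    Tendsto (fun η : ℝ => η * auxValue μ y q g η) atTop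
      (𝓝 ((riemannZeta 2).re / 2 * ∑ i, ∑ j ∈ Finset.Ioi i,
        (sliceMass p y g i j 0 0).toReal / ‖y i - y j‖)) := by
  have hz := re_riemannZeta_two_nonneg
  set C : Fin n → Fin n → ℝ := fun i j => 1 / (2 * ‖y i - y j‖) with hC
  set Λ : ℝ → ℝ≥0∞ := fun a => ∑ i, ∑ j ∈ Finset.univ.erase i,
    ENNReal.ofReal (C i j) * (ENNReal.ofReal ((riemannZeta 2).re / 2) * sliceMass p y g i j 0 a)
    with hΛ
  have hfin0 : ∀ i j, i ≠ j → sliceMass p y g i j 0 0 ≠ ∞ := fun i j hij =>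
    ((hs i j hij).1.self_of_nhdsWithin Set.self_mem_Ici).1
  have hcont0 : ∀ i j, i ≠ j →
      ContinuousWithinAt (fun t => sliceMass p y g i j t 0) (Set.Ici 0) 0 := fun i j hij =>
    ((hs i j hij).1.self_of_nhdsWithin Set.self_mem_Ici).2
  have hΛ0 : Λ 0 ≠ ∞ := by
    refine ENNReal.sum_ne_top.2 fun i _ => ENNReal.sum_ne_top.2 fun j hj => ?_
    exact ENNReal.mul_ne_top ENNReal.ofReal_ne_top (ENNReal.mul_ne_top ENNReal.ofReal_ne_top
      (hfin0 i j (Finset.ne_of_mem_erase hj).symm))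
  have hΛlim : Tendsto Λ (𝓝[>] 0) (𝓝 (Λ 0)) := by
    refine tendsto_finsetSum _ fun i _ => tendsto_finsetSum _ fun j hj => ?_
    refine ENNReal.Tendsto.const_mul (ENNReal.Tendsto.const_mul ?_ (Or.inr ENNReal.ofReal_ne_top))
      (Or.inr ENNReal.ofReal_ne_top)
    exact (hs i j (Finset.ne_of_mem_erase hj).symm).2.mono_left
      (nhdsWithin_mono _ Set.Ioi_subset_Ici_self)
  have hupper := tendsto_mul_sum_lintegral C (h := fun i j t => sliceMass p y g i j t 0)
    (fun i j hij => measurable_sliceMass (hy.ne hij) hp 0) hfin0 hcont0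
    (fun i j hij => lintegral_sliceMass_ne_top hp hμ (hy.ne hij) 0)
  have hlim : Tendsto (fun η : ℝ => ENNReal.ofReal (η * auxValue μ y q g η)) atTop (𝓝 (Λ 0)) := by
    refine tendsto_order.2 ⟨fun b hb => ?_, fun b hb => ?_⟩
    · have hgood : ∀ᶠ a in 𝓝[>] (0 : ℝ), ∀ i j, i ≠ j → sliceMass p y g i j 0 a ≠ ∞ ∧
          ContinuousWithinAt (fun t => sliceMass p y g i j t a) (Set.Ici 0) 0 := by
        refine eventually_all.2 fun i => eventually_all.2 fun j => eventually_all.2 fun hij => ?_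
        exact (hs i j hij).1.filter_mono (nhdsWithin_mono _ Set.Ioi_subset_Ici_self)
      have hpos : ∀ᶠ a in 𝓝[>] (0 : ℝ), 0 < a := eventually_mem_nhdsWithin
      -- The width is strictly positive, so that truncating to `t < a` does not affect the behaviour
      -- at `t = 0`.
      obtain ⟨a, hba, ha, hgood⟩ :=
        ((hΛlim.eventually_const_lt hb).and (hpos.and hgood)).exists
      set h : Fin n → Fin n → ℝ → ℝ≥0∞ := fun i j => (Set.Iio a).indicator
        (fun t => min (sliceMass p y g i j t a) (sliceMass p y g j i t a)) with hh
      have hle : ∀ i j t, h i j t ≤ sliceMass p y g i j t a := fun i j t =>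
        (Set.indicator_le_self' (fun _ _ => zero_le) t).trans (min_le_left _ _)
      -- Both sides agree at `t = 0`, so the minimum costs nothing in the limit.
      have hval : ∀ i j, h i j 0 = sliceMass p y g i j 0 a := fun i j => by
        simp [hh, ha, ← sliceMass_zero_comm y g p i j a]
      have hlow := tendsto_mul_sum_lintegral C (h := h)
        (fun i j hij => ((measurable_sliceMass (hy.ne hij) hp a).min
          (measurable_sliceMass (hy.ne hij.symm) hp a)).indicator measurableSet_Iio)
        (fun i j hij => (hval i j).symm ▸ (hgood i j hij).1)
        (fun i j hij => by
          have hmin : ContinuousWithinAt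
              (fun t => min (sliceMass p y g i j t a) (sliceMass p y g j i t a)) (Set.Ici 0) 0 :=
            (hgood i j hij).2.min (hgood j i hij.symm).2
          refine hmin.congr_of_eventuallyEq ?_ (by simp [hh, ha])
          filter_upwards [mem_nhdsWithin_of_mem_nhds (Iio_mem_nhds ha)] with t ht
          simp only [hh, Set.indicator_of_mem ht])
        (fun i j hij => ne_top_of_le_ne_top (lintegral_sliceMass_ne_top hp hμ (hy.ne hij) a)
          (lintegral_mono fun t => hle i j t))
      simp_rw [hval] at hlow
      filter_upwards [hlow.eventually_const_lt hba, eventually_gt_atTop 0] with η hη hη0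
      refine hη.trans_le ?_
      rw [ENNReal.ofReal_mul hη0.le]
      refine mul_le_mul_right ?_ _
      have hbound := le_ofReal_auxObjective (g := g) hy hp hμ hη0.le a
      rw [← ENNReal.ofReal_toReal (ne_top_of_le_ne_top ENNReal.ofReal_ne_top (hbound 0))]
      exact ENNReal.ofReal_le_ofReal (le_auxValue fun δ _ =>
        ENNReal.toReal_le_of_le_ofReal (auxObjective_nonneg η δ) (hbound δ))
    · filter_upwards [hupper.eventually_lt_const hb, eventually_gt_atTop 0] with η hη hη0
      refine lt_of_le_of_lt ?_ hη
      rw [ENNReal.ofReal_mul hη0.le]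
      exact mul_le_mul_right ((ENNReal.ofReal_le_ofReal (auxValue_le η (by simp))).trans
        (ofReal_auxObjective_zero_le hy hp hμ hη0.le)) _
  have hreal := (ENNReal.tendsto_toReal hΛ0).comp hlim
  have hval : (Λ 0).toReal = (riemannZeta 2).re / 2 * ∑ i, ∑ j ∈ Finset.Ioi i,
      (sliceMass p y g i j 0 0).toReal / ‖y i - y j‖ := by
    have h1 : (Λ 0).toReal = ∑ i, ∑ j ∈ Finset.univ.erase i,
        C i j * ((riemannZeta 2).re / 2 * (sliceMass p y g i j 0 0).toReal) := by
      have hterm : ∀ i, ∀ j ∈ Finset.univ.erase i, ENNReal.ofReal (C i j) *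
          (ENNReal.ofReal ((riemannZeta 2).re / 2) * sliceMass p y g i j 0 0) ≠ ∞ := fun i j hj =>
        ENNReal.mul_ne_top ENNReal.ofReal_ne_top (ENNReal.mul_ne_top ENNReal.ofReal_ne_top
          (hfin0 i j (Finset.ne_of_mem_erase hj).symm))
      rw [hΛ, ENNReal.toReal_sum fun i _ => ENNReal.sum_ne_top.2 (hterm i)]
      refine Finset.sum_congr rfl fun i _ => ?_
      rw [ENNReal.toReal_sum (hterm i)]
      refine Finset.sum_congr rfl fun j _ => ?_
      rw [ENNReal.toReal_mul, ENNReal.toReal_mul, ENNReal.toReal_ofReal (by positivity),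
        ENNReal.toReal_ofReal (by positivity)]
    -- Each unordered pair occurs twice with weight `1 / (2 ‖y i - y j‖)`.
    have hoff := Finset.sum_sum_Ioi_add_eq_sum_sum_off_diag
      (fun j i => C i j * ((riemannZeta 2).re / 2 * (sliceMass p y g i j 0 0).toReal))
    rw [h1, Finset.mul_sum]
    simp_rw [← Finset.compl_singleton]
    rw [← hoff]
    refine Finset.sum_congr rfl fun i _ => ?_
    rw [Finset.mul_sum]
    refine Finset.sum_congr rfl fun j _ => ?_
    simp only [hC]
    rw [norm_sub_rev (y j) (y i), sliceMass_zero_comm y g p j i]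
    field_simp
    ring
  rw [hval] at hreal
  refine hreal.congr' ?_
  filter_upwards [eventually_ge_atTop 0] with η hη
  exact ENNReal.toReal_ofReal (mul_nonneg hη (auxValue_nonneg η))

end Limit

/-! ## Cells with nonempty interior -/

section Interior

variable {d n : ℕ} {y : Fin n → EuclideanSpace ℝ (Fin d)} {g : Fin n → ℝ}

lemma volume_slack_eq_zero {i j : Fin n} (hij : y i ≠ y j) :
    volume {x | slack y g i j x = 0} = 0 := by
  obtain ⟨m, rfl⟩ := exists_eq_add_one_of_ne hij
  obtain ⟨c, v, ι, h⟩ := exists_isSlackChart y g i j hij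
  have hm : MeasurableSet {x | slack y g i j x = 0} :=
    measurableSet_eq_fun (continuous_slack y g i j).measurable measurable_const
  rw [← lintegral_indicator_one hm, h.lintegral_eq _ (measurable_one.indicator hm)]
  refine mul_eq_zero_of_right _ (lintegral_eq_zero_of_ae_eq_zero ?_)
  filter_upwards [Measure.ae_ne volume (0 : ℝ)] with t ht
  simp [h.slack_eq, ht]

lemma volume_powerCell_inter {i j : Fin n} (hij : y i ≠ y j) :
    volume (powerCell y g i ∩ powerCell y g j) = 0 := by
  rw [powerCell_inter_powerCell]
  exact measure_mono_null (fun x hx => hx.2) (volume_slack_eq_zero (g := g) hij)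

/-- A cell without points of strict minimum would be covered by finitely many null hyperplanes. -/
lemma mapFibre_nonempty (hy : Function.Injective y) {i : Fin n}
    (h : volume (powerCell y g i) ≠ 0) : (mapFibre y g i).Nonempty := by
  by_contra hne
  rw [Set.not_nonempty_iff_eq_empty] at hne
  refine h (measure_mono_null (t := ⋃ j, ⋃ (_ : j ≠ i), {x | slack y g i j x = 0}) ?_ ?_)
  · intro x hx
    have hx' : x ∉ mapFibre y g i := by simp [hne]
    rw [mem_mapFibre_iff] at hx'
    push Not at hx'
    obtain ⟨j, hj, hle⟩ := hx'
    simp only [Set.mem_iUnion]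
    exact ⟨j, hj, le_antisymm hle ((mem_powerCell_iff y g).1 hx j)⟩
  · exact measure_iUnion_null fun j => measure_iUnion_null fun hj =>
      volume_slack_eq_zero (hy.ne hj.symm)

lemma isClosed_powerCell (i : Fin n) : IsClosed (powerCell y g i) := by
  have : powerCell y g i = ⋂ j, {x | 0 ≤ slack y g i j x} := by
    ext x; simp [mem_powerCell_iff]
  rw [this]
  exact isClosed_iInter fun j => isClosed_le continuous_const (continuous_slack y g i j)

/-- Slacks are affine: on the segment from a point of the cell to a point of the fibre, all points
but possibly the first have strictly positive slacks. -/
lemma closure_mapFibre {i : Fin n} (h : (mapFibre y g i).Nonempty) :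
    closure (mapFibre y g i) = powerCell y g i := by
  refine (closure_minimal (fun x hx => ?_) (isClosed_powerCell i)).antisymm fun x hx => ?_
  · rw [mem_powerCell_iff]
    intro j
    by_cases hj : j = i
    · rw [hj, slack_self]
    · exact ((mem_mapFibre_iff y g).1 hx j hj).le
  · obtain ⟨z, hz⟩ := h
    have hlim : Tendsto (fun s : ℝ => x + s • (z - x)) (𝓝[>] 0) (𝓝 x) := by
      have : Continuous fun s : ℝ => x + s • (z - x) := by fun_prop
      simpa using (this.tendsto 0).mono_left nhdsWithin_le_nhds
    refine mem_closure_of_tendsto hlim ?_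
    filter_upwards [Ioo_mem_nhdsGT (zero_lt_one (α := ℝ))] with s hs
    rw [mem_mapFibre_iff]
    intro j hj
    have hz' := (mem_mapFibre_iff y g).1 hz j hj
    have hx' := (mem_powerCell_iff y g).1 hx j
    have h1 : slack y g i j (x + s • (z - x)) =
        (1 - s) * slack y g i j x + s * slack y g i j z := by
      rw [slack_add, real_inner_smul_left]
      have := slack_add y g i j x (z - x)
      rw [add_sub_cancel] at this
      rw [this]; ring
    rw [h1]
    exact add_pos_of_nonneg_of_pos (mul_nonneg (by linarith [hs.2]) hx') (mul_pos hs.1 hz')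

lemma boundaryMass_eq_sliceMass (h : ∀ i, (mapFibre y g i).Nonempty)
    (p : EuclideanSpace ℝ (Fin d) → ℝ) (i j : Fin n) :
    boundaryMass p y g i j = sliceMass p y g i j 0 0 := by
  rw [boundaryMass, closure_mapFibre (h i), closure_mapFibre (h j), powerCell_inter_powerCell,
    sliceMass]

end Interior

/-! ## Continuity of the slices for regular densities -/

section RegularDensity

variable {m n : ℕ} {y : Fin n → EuclideanSpace ℝ (Fin (m + 1))} {g : Fin n → ℝ} {i j k : Fin n}
  {c v : EuclideanSpace ℝ (Fin (m + 1))}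
  {ι : EuclideanSpace ℝ (Fin m) →ₗᵢ[ℝ] EuclideanSpace ℝ (Fin (m + 1))}

namespace IsSlackChart

/-- Three cells with nonempty interior do not meet along a common hyperplane. -/
lemma slack_ne_zero (h : IsSlackChart y g i j c v ι) (hne : ∀ i, (mapFibre y g i).Nonempty)
    (hij : i ≠ j) (hki : k ≠ i) (hkj : k ≠ j) (hort : ∀ w, ⟪ι w, y i - y k⟫ = 0) :
    slack y g i k c ≠ 0 := by
  intro h0
  set r := 2 * ⟪v, y i - y k⟫ with hr
  have hlin : ∀ x, slack y g i k x = r * slack y g i j x := by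
    intro x
    obtain ⟨w, hw⟩ := h.exists_eq x
    conv_lhs => rw [hw]
    rw [slack_add, slack_add, h0, hort, real_inner_smul_left, hr]
    ring
  obtain ⟨xi, hxi⟩ := hne i
  obtain ⟨xj, hxj⟩ := hne j
  obtain ⟨xk, hxk⟩ := hne k
  rw [mem_mapFibre_iff] at hxi hxj hxk
  have i1 := hxi j hij.symm
  have i2 := hxi k hki
  have j1 := hxj i hij
  have j2 := hxj k hkj
  have k1 := hxk i hki.symm
  have k2 := hxk j hkj.symm
  rw [← slack_sub_slack y g i, slack_self] at j1 k1
  rw [← slack_sub_slack y g i] at j2 k2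
  rw [hlin] at i2 j2 k1 k2
  -- Write `s` for `Δ_ij`. The point of cell `i` forces `r > 0`, that of cell `j` forces `r < 1`,
  -- and then the point of cell `k` needs both `s < 0` and `s > 0`.
  have hr0 : 0 < r := (pos_iff_pos_of_mul_pos i2).2 i1
  have hr1 : r < 1 := by nlinarith
  nlinarith

/-- A level set of a nonconstant affine function is empty or a translate of a proper subspace. -/
lemma volume_slack_eq (h : ∃ w, ⟪ι w, y i - y k⟫ ≠ 0) (a : ℝ) (x : EuclideanSpace ℝ (Fin (m + 1))) :
    volume {w | slack y g i k (x + ι w) = a} = 0 := by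
  let ℓ : EuclideanSpace ℝ (Fin m) →ₗ[ℝ] ℝ :=
    (innerₗ _ (y i - y k)).comp ι.toLinearMap
  have hℓ : ∀ w, ℓ w = ⟪ι w, y i - y k⟫ := fun w => by
    rw [real_inner_comm]; rfl
  have hker : ℓ.ker ≠ ⊤ := by
    obtain ⟨w, hw⟩ := h
    intro htop
    have : w ∈ ℓ.ker := htop ▸ Submodule.mem_top
    rw [LinearMap.mem_ker, hℓ] at this
    exact hw this
  by_cases hex : ∃ w₀, slack y g i k (x + ι w₀) = a
  · obtain ⟨w₀, hw₀⟩ := hex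
    have hset : {w | slack y g i k (x + ι w) = a} = (fun w => w + -w₀) ⁻¹' (ℓ.ker : Set _) := by
      ext w
      simp only [Set.mem_preimage, SetLike.mem_coe, LinearMap.mem_ker, ← sub_eq_add_neg, hℓ,
        map_sub, inner_sub_left]
      rw [slack_add] at hw₀
      change slack y g i k (x + ι w) = a ↔ _
      rw [slack_add]
      exact ⟨fun h => by linarith, fun h => by linarith⟩
    rw [hset, measure_preimage_add_right]
    exact Measure.addHaar_submodule volume _ hker
  · have hset : {w | slack y g i k (x + ι w) = a} = ∅ :=
      Set.eq_empty_of_forall_notMem fun w hw => hex ⟨w, hw⟩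
    rw [hset, measure_empty]

/-- On the hyperplane `Δ_ij = 0` the slack `Δ_ik` is either nonconstant, with null level sets, or a
constant. The constant is nonzero by `slack_ne_zero`, hence differs from every small `a`. -/
lemma eventually_ae_slack_ne (h : IsSlackChart y g i j c v ι)
    (hne : ∀ i, (mapFibre y g i).Nonempty) (hij : i ≠ j) :
    ∀ᶠ a in 𝓝 (0 : ℝ), ∀ᵐ w, ∀ k, k ≠ i → k ≠ j → slack y g i k (c + (0 : ℝ) • v + ι w) ≠ a := by
  simp_rw [ae_all_iff, zero_smul, add_zero]
  refine eventually_all.2 fun k => eventually_all.2 fun hki => eventually_all.2 fun hkj => ?_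
  by_cases hex : ∃ w, ⟪ι w, y i - y k⟫ ≠ 0
  · refine Eventually.of_forall fun a => ?_
    rw [ae_iff]
    simpa using volume_slack_eq (g := g) hex a c
  · push Not at hex
    filter_upwards [isOpen_ne.mem_nhds (h.slack_ne_zero hne hij hki hkj hex).symm] with a ha
    refine ae_of_all _ fun w => ?_
    rw [slack_add, hex, mul_zero, add_zero]
    exact Ne.symm ha

variable {p : EuclideanSpace ℝ (Fin (m + 1)) → ℝ} {C R : ℝ}

/-- A dominating function independent of `t` and of the set: `norm_le` keeps `w` in a fixed ball
wherever `p` does not vanish. -/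
lemma indicator_le (h : IsSlackChart y g i j c v ι) (hC : ∀ x, p x ≤ C)
    (hR : ∀ x, p x ≠ 0 → ‖x‖ ≤ R) (A : Set (EuclideanSpace ℝ (Fin (m + 1)))) (t : ℝ)
    (w : EuclideanSpace ℝ (Fin m)) :
    A.indicator (fun x => ENNReal.ofReal (p x)) (c + t • v + ι w) ≤
      (Metric.closedBall 0 R).indicator (fun _ => ENNReal.ofReal C) w := by
  by_cases hp : p (c + t • v + ι w) = 0
  · refine le_trans ?_ zero_le
    by_cases hA : c + t • v + ι w ∈ A <;> simp [hA, hp]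
  · have hw : w ∈ Metric.closedBall (0 : EuclideanSpace ℝ (Fin m)) R := by
      rw [mem_closedBall_zero_iff]
      exact (h.norm_le t w).trans (hR _ hp)
    rw [Set.indicator_of_mem hw]
    exact (Set.indicator_le_self' (fun _ _ => zero_le) _).trans (ENNReal.ofReal_le_ofReal (hC _))

lemma lintegral_bound_ne_top : ∫⁻ w : EuclideanSpace ℝ (Fin m),
    (Metric.closedBall 0 R).indicator (fun _ => ENNReal.ofReal C) w ≠ ∞ := by
  rw [lintegral_indicator Metric.isClosed_closedBall.measurableSet, setLIntegral_const]
  exact ENNReal.mul_ne_top ENNReal.ofReal_ne_top measure_closedBall_lt_top.ne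

lemma sliceMass_ne_top (h : IsSlackChart y g i j c v ι) (hp : Measurable p) (hC : ∀ x, p x ≤ C)
    (hR : ∀ x, p x ≠ 0 → ‖x‖ ≤ R) (t a : ℝ) : sliceMass p y g i j t a ≠ ∞ := by
  rw [h.sliceMass_eq hp]
  exact ne_top_of_le_ne_top (lintegral_bound_ne_top (C := C) (R := R))
    (lintegral_mono fun w => h.indicator_le hC hR _ t w)

lemma measurable_indicator_comp (hp : Measurable p) (t a : ℝ) :
    Measurable fun w => (shrunkCell y g i j a).indicator (fun x => ENNReal.ofReal (p x))
      (c + t • v + ι w) :=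
  (hp.ennreal_ofReal.indicator (measurableSet_shrunkCell y g i j a)).comp
    (isometry t).continuous.measurable

/-- Dominated convergence. For almost every `w` no other slack equals `a`, so membership in the
shrunk cell does not change for small `t ≥ 0`, and inside it `p` is continuous at the limit point.
-/
lemma continuousWithinAt_sliceMass (h : IsSlackChart y g i j c v ι) (hp : Measurable p)
    (hC : ∀ x, p x ≤ C) (hR : ∀ x, p x ≠ 0 → ‖x‖ ≤ R)
    (hcont : ∀ᵐ w, c + (0 : ℝ) • v + ι w ∈ powerCell y g i ∩ powerCell y g j →
      ContinuousAt p (c + (0 : ℝ) • v + ι w)) {a : ℝ} (ha : 0 ≤ a)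
    (hae : ∀ᵐ w, ∀ k, k ≠ i → k ≠ j → slack y g i k (c + (0 : ℝ) • v + ι w) ≠ a) :
    ContinuousWithinAt (fun t => sliceMass p y g i j t a) (Set.Ici 0) 0 := by
  unfold ContinuousWithinAt
  simp_rw [h.sliceMass_eq hp]
  refine tendsto_lintegral_filter_of_dominated_convergence _
    (Eventually.of_forall fun t => measurable_indicator_comp hp t a)
    (Eventually.of_forall fun t => ae_of_all _ fun w => h.indicator_le hC hR _ t w)
    lintegral_bound_ne_top ?_
  filter_upwards [hcont, hae] with w hw hne
  have hχ : Tendsto (fun t : ℝ => c + t • v + ι w) (𝓝[≥] 0) (𝓝 (c + (0 : ℝ) • v + ι w)) := by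
    have : Continuous fun t : ℝ => c + t • v + ι w := by fun_prop
    exact (this.tendsto 0).mono_left nhdsWithin_le_nhds
  have hsl : ∀ k, Tendsto (fun t : ℝ => slack y g i k (c + t • v + ι w)) (𝓝[≥] 0)
      (𝓝 (slack y g i k (c + (0 : ℝ) • v + ι w))) := fun k =>
    ((continuous_slack y g i k).tendsto _).comp hχ
  have hnonneg : ∀ᶠ t in 𝓝[≥] (0 : ℝ), 0 ≤ t := eventually_mem_nhdsWithin
  by_cases hmem : c + (0 : ℝ) • v + ι w ∈ shrunkCell y g i j a
  · have hmem' := (mem_shrunkCell_iff y g ha).1 hmem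
    have hp0 : ContinuousAt p (c + (0 : ℝ) • v + ι w) := hw <| by
      rw [powerCell_inter_powerCell, slice, shrunkCell_zero]
      exact ⟨hmem.1, h.slack_eq 0 w⟩
    have hev : ∀ᶠ t in 𝓝[≥] (0 : ℝ), ∀ k, k ≠ i → k ≠ j → a < slack y g i k (c + t • v + ι w) := by
      refine eventually_all.2 fun k => eventually_all.2 fun hki => eventually_all.2 fun hkj => ?_
      exact (hsl k).eventually_const_lt (lt_of_le_of_ne (hmem'.2 k hki hkj) (hne k hki hkj).symm)
    rw [Set.indicator_of_mem hmem]
    refine (ENNReal.tendsto_ofReal (hp0.tendsto.comp hχ)).congr' ?_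
    filter_upwards [hev, hnonneg] with t ht ht0
    rw [Set.indicator_of_mem]
    · rfl
    · rw [mem_shrunkCell_iff y g ha, h.slack_eq]
      exact ⟨ht0, fun k hki hkj => (ht k hki hkj).le⟩
  · have hex : ∃ k, k ≠ i ∧ k ≠ j ∧ slack y g i k (c + (0 : ℝ) • v + ι w) < a := by
      by_contra hcon
      push Not at hcon
      exact hmem ((mem_shrunkCell_iff y g ha).2 ⟨(h.slack_eq 0 w).ge, hcon⟩)
    obtain ⟨k, hki, hkj, hk⟩ := hex
    rw [Set.indicator_of_notMem hmem]
    refine tendsto_const_nhds.congr' ?_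
    filter_upwards [(hsl k).eventually_lt_const hk] with t ht
    rw [Set.indicator_of_notMem]
    exact fun hcon => absurd (hcon.2 k hki hkj) (not_le.2 ht)

/-- Only the domain depends on `a`, and for almost every `w` membership is eventually constant;
continuity of `p` plays no role. -/
lemma continuousWithinAt_sliceMass_zero (h : IsSlackChart y g i j c v ι) (hp : Measurable p)
    (hC : ∀ x, p x ≤ C) (hR : ∀ x, p x ≠ 0 → ‖x‖ ≤ R)
    (hae : ∀ᵐ w, ∀ k, k ≠ i → k ≠ j → slack y g i k (c + (0 : ℝ) • v + ι w) ≠ 0) :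
    ContinuousWithinAt (fun a => sliceMass p y g i j 0 a) (Set.Ici 0) 0 := by
  unfold ContinuousWithinAt
  simp_rw [h.sliceMass_eq hp]
  refine tendsto_lintegral_filter_of_dominated_convergence _
    (Eventually.of_forall fun a => measurable_indicator_comp hp 0 a)
    (Eventually.of_forall fun a => ae_of_all _ fun w => h.indicator_le hC hR _ 0 w)
    lintegral_bound_ne_top ?_
  filter_upwards [hae] with w hne
  have hnonneg : ∀ᶠ a in 𝓝[≥] (0 : ℝ), 0 ≤ a := eventually_mem_nhdsWithin
  refine tendsto_const_nhds.congr' ?_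
  by_cases hmem : c + (0 : ℝ) • v + ι w ∈ shrunkCell y g i j 0
  · have hmem' := (mem_shrunkCell_iff y g le_rfl).1 hmem
    have hev : ∀ᶠ a in 𝓝[≥] (0 : ℝ), ∀ k, k ≠ i → k ≠ j →
        a < slack y g i k (c + (0 : ℝ) • v + ι w) := by
      refine eventually_all.2 fun k => eventually_all.2 fun hki => eventually_all.2 fun hkj => ?_
      exact mem_nhdsWithin_of_mem_nhds
        (Iio_mem_nhds (lt_of_le_of_ne (hmem'.2 k hki hkj) (hne k hki hkj).symm))
    filter_upwards [hev, hnonneg] with a ha ha0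
    rw [Set.indicator_of_mem hmem, Set.indicator_of_mem]
    rw [mem_shrunkCell_iff y g ha0]
    exact ⟨hmem'.1, fun k hki hkj => (ha k hki hkj).le⟩
  · filter_upwards [hnonneg] with a ha0
    rw [Set.indicator_of_notMem hmem, Set.indicator_of_notMem]
    exact fun hcon => hmem ⟨hcon.1, fun k hki hkj => ha0.trans (hcon.2 k hki hkj)⟩

end IsSlackChart

end RegularDensity

lemma RegularDensity.slicesContinuous {d n : ℕ} {μ : Measure (EuclideanSpace ℝ (Fin d))}
    {p : EuclideanSpace ℝ (Fin d) → ℝ} {y : Fin n → EuclideanSpace ℝ (Fin d)} {g : Fin n → ℝ}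
    (h : RegularDensity μ p y g) (hp : Measurable p) (hy : Function.Injective y)
    (hne : ∀ i, (mapFibre y g i).Nonempty) : SlicesContinuous p y g := by
  intro i j hij
  obtain ⟨m, rfl⟩ := exists_eq_add_one_of_ne (hy.ne hij)
  obtain ⟨c, v, ι, hχ⟩ := exists_isSlackChart y g i j (hy.ne hij)
  obtain ⟨C, hC⟩ := h.bounded
  obtain ⟨R, hR⟩ := h.compact.isBounded.exists_norm_le
  have hR' : ∀ x, p x ≠ 0 → ‖x‖ ≤ R := fun x hx => hR x (by
    by_contra hcon
    exact hx (h.eq_zero x hcon))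
  have hms := (measurableSet_powerCell y g i).inter (measurableSet_powerCell y g j)
  have hcont : ∀ᵐ w, c + (0 : ℝ) • v + ι w ∈ powerCell y g i ∩ powerCell y g j →
      ContinuousAt p (c + (0 : ℝ) • v + ι w) := by
    -- The almost-everywhere hypothesis moves from Hausdorff measure on the hyperplane to Lebesgue
    -- measure in `w`. Off the frontier, `p` is continuous in the interior and locally zero in the
    -- exterior.
    have h1 := ae_restrict_of_ae (s := {x | slack y g i j x = 0})
      ((ae_restrict_iff' hms).1 (h.continuous_interface i j hij))
    rw [Nat.add_sub_cancel, ← hχ.map_volume 0] at h1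
    have h2 := ae_of_ae_map (IsSlackChart.isometry 0).continuous.measurable.aemeasurable h1
    filter_upwards [h2] with w hw hmem
    set x := c + (0 : ℝ) • v + ι w with hx
    by_cases hfr : x ∈ frontier μ.support
    · exact hw hmem hfr
    · by_cases hint : x ∈ interior μ.support
      · exact h.continuous_interior x hint
      · have hout : x ∉ μ.support := fun hcon => hfr ⟨subset_closure hcon, hint⟩
        have : p =ᶠ[𝓝 x] fun _ => 0 := by
          filter_upwards [Measure.isClosed_support.isOpen_compl.mem_nhds hout] with z hz
          exact h.eq_zero z hz
        exact continuousAt_const.congr this.symm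
  have hev := hχ.eventually_ae_slack_ne hne hij
  refine ⟨?_, hχ.continuousWithinAt_sliceMass_zero hp hC hR' hev.self_of_nhds⟩
  filter_upwards [mem_nhdsWithin_of_mem_nhds hev, self_mem_nhdsWithin] with a ha ha0
  exact ⟨hχ.sliceMass_ne_top hp hC hR' 0 a,
    hχ.continuousWithinAt_sliceMass hp hC hR' hcont ha0 ha⟩

/-! ## Finitely supported measures -/

section Atomic

variable {E : Type*} [MeasurableSpace E] [MeasurableSingletonClass E] {n : ℕ} {ν : Measure E}
  {y : Fin n → E} {q : Fin n → ℝ}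

lemma integrable_of_atomic (hν : ν = ∑ i, ENNReal.ofReal (q i) • Measure.dirac (y i))
    (φ : E → ℝ) : Integrable φ ν := by
  rw [hν, integrable_finsetSum_measure]
  exact fun i _ => (integrable_dirac (by simp)).smul_measure ENNReal.ofReal_ne_top

lemma integral_of_atomic (hν : ν = ∑ i, ENNReal.ofReal (q i) • Measure.dirac (y i))
    (hq : ∀ i, 0 < q i) (φ : E → ℝ) : ∫ z, φ z ∂ν = ∑ i, q i * φ (y i) := by
  rw [hν, integral_finsetSum_measure fun i _ =>
    (integrable_dirac (by simp)).smul_measure ENNReal.ofReal_ne_top]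
  refine Finset.sum_congr rfl fun i _ => ?_
  rw [integral_smul_measure, integral_dirac, ENNReal.toReal_ofReal (hq i).le, smul_eq_mul]

lemma lintegral_of_atomic (hν : ν = ∑ i, ENNReal.ofReal (q i) • Measure.dirac (y i))
    (φ : E → ℝ≥0∞) : ∫⁻ z, φ z ∂ν = ∑ i, ENNReal.ofReal (q i) * φ (y i) := by
  rw [hν, lintegral_finsetSum_measure]
  refine Finset.sum_congr rfl fun i _ => ?_
  rw [lintegral_smul_measure, lintegral_dirac, smul_eq_mul]

lemma ae_of_atomic (hν : ν = ∑ i, ENNReal.ofReal (q i) • Measure.dirac (y i))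
    (hq : ∀ i, 0 < q i) {P : E → Prop} : (∀ᵐ z ∂ν, P z) ↔ ∀ i, P (y i) := by
  have hsum : ∀ s : Set E, ν s = ∑ i, ENNReal.ofReal (q i) * s.indicator 1 (y i) := by
    intro s
    rw [hν, Measure.finsetSum_apply]
    exact Finset.sum_congr rfl fun i _ => by
      rw [Measure.smul_apply, Measure.dirac_apply, smul_eq_mul]
  rw [ae_iff, hsum, Finset.sum_eq_zero_iff]
  refine forall_congr' fun i => ?_
  have := hq i
  by_cases h : P (y i) <;> simp [h, this]

lemma sum_weights_eq_one [IsProbabilityMeasure ν]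
    (hν : ν = ∑ i, ENNReal.ofReal (q i) • Measure.dirac (y i)) (hq : ∀ i, 0 < q i) :
    ∑ i, q i = 1 := by
  have := integral_of_atomic hν hq fun _ => 1
  simpa using this.symm

end Atomic

/-! ## The reduced costs and their minimum -/

section ReducedCost

variable {d n : ℕ} (y : Fin n → EuclideanSpace ℝ (Fin d)) (g : Fin n → ℝ)

/-- The function `x ↦ ‖x - y_i‖² - g_i`. -/
noncomputable def reducedCost (i : Fin n) (x : EuclideanSpace ℝ (Fin d)) : ℝ := ‖x - y i‖ ^ 2 - g i

/-- The function `x ↦ min_i (‖x - y_i‖² - g_i)`. -/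
noncomputable def cTransform (x : EuclideanSpace ℝ (Fin d)) : ℝ := ⨅ i, reducedCost y g i x

lemma continuous_reducedCost (i : Fin n) : Continuous (reducedCost y g i) := by
  unfold reducedCost; fun_prop

lemma slack_eq_reducedCost_sub (i j : Fin n) (x : EuclideanSpace ℝ (Fin d)) :
    slack y g i j x = reducedCost y g j x - reducedCost y g i x := by
  unfold slack reducedCost; ring

lemma cTransform_le (i : Fin n) (x : EuclideanSpace ℝ (Fin d)) :
    cTransform y g x ≤ reducedCost y g i x :=
  ciInf_le (Set.finite_range _).bddBelow i

lemma exists_reducedCost_eq [Nonempty (Fin n)] (x : EuclideanSpace ℝ (Fin d)) :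
    ∃ i, reducedCost y g i x = cTransform y g x :=
  exists_eq_ciInf_of_finite

lemma mem_powerCell_iff_reducedCost_eq [Nonempty (Fin n)] {i : Fin n}
    {x : EuclideanSpace ℝ (Fin d)} :
    x ∈ powerCell y g i ↔ reducedCost y g i x = cTransform y g x :=
  ⟨fun h => le_antisymm (le_ciInf fun j => h j) (cTransform_le y g i x),
    fun h j => h.trans_le (cTransform_le y g j x)⟩

lemma iUnion_powerCell [Nonempty (Fin n)] : ⋃ i, powerCell y g i = Set.univ := by
  refine Set.eq_univ_of_forall fun x => Set.mem_iUnion.2 ?_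
  obtain ⟨i, hi⟩ := exists_reducedCost_eq y g x
  exact ⟨i, (mem_powerCell_iff_reducedCost_eq y g).2 hi⟩

lemma measurable_cTransform : Measurable (cTransform y g) :=
  Measurable.iInf fun i => (continuous_reducedCost y g i).measurable

variable {μ : Measure (EuclideanSpace ℝ (Fin d))} [IsProbabilityMeasure μ]

lemma integrable_norm_sub_sq (h2 : Integrable (fun x => ‖x‖ ^ 2) μ)
    (z : EuclideanSpace ℝ (Fin d)) : Integrable (fun x => ‖x - z‖ ^ 2) μ := by
  refine Integrable.mono' ((h2.const_mul 2).add (integrable_const (2 * ‖z‖ ^ 2)))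
    (by fun_prop) (ae_of_all _ fun x => ?_)
  rw [Real.norm_of_nonneg (by positivity)]
  have h1 := norm_sub_le x z
  have h3 := norm_nonneg (x - z)
  simp only [Pi.add_apply]
  nlinarith [sq_nonneg (‖x‖ - ‖z‖)]

lemma integrable_reducedCost (h2 : Integrable (fun x => ‖x‖ ^ 2) μ) (i : Fin n) :
    Integrable (reducedCost y g i) μ :=
  (integrable_norm_sub_sq h2 (y i)).sub (integrable_const _)

lemma integrable_cTransform [Nonempty (Fin n)] (h2 : Integrable (fun x => ‖x‖ ^ 2) μ) :
    Integrable (cTransform y g) μ := by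
  refine Integrable.mono' (integrable_finsetSum Finset.univ fun i _ =>
    (integrable_reducedCost y g h2 i).norm) (measurable_cTransform y g).aestronglyMeasurable
    (ae_of_all _ fun x => ?_)
  obtain ⟨i, hi⟩ := exists_reducedCost_eq y g x
  rw [← hi]
  exact Finset.single_le_sum (f := fun i => ‖reducedCost y g i x‖) (fun _ _ => norm_nonneg _)
    (Finset.mem_univ i)

variable {y}

lemma integral_eq_sum_powerCell {μ : Measure (EuclideanSpace ℝ (Fin d))} [Nonempty (Fin n)]
    (hy : Function.Injective y) (hac : μ ≪ volume) {φ : EuclideanSpace ℝ (Fin d) → ℝ} (hφ : Integrable φ μ) :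
    ∫ x, φ x ∂μ = ∑ i, ∫ x in powerCell y g i, φ x ∂μ := by
  rw [← setIntegral_univ, ← iUnion_powerCell y g, integral_iUnion_ae
    (fun i => (measurableSet_powerCell y g i).nullMeasurableSet)
    (fun i j hij => hac (volume_powerCell_inter (hy.ne hij))) hφ.integrableOn, tsum_fintype]

end ReducedCost

/-! ## Optimal potentials -/

section Potentials

variable {d n : ℕ} {μ ν : Measure (EuclideanSpace ℝ (Fin d))}
  {y : Fin n → EuclideanSpace ℝ (Fin d)} {q : Fin n → ℝ} {f g : EuclideanSpace ℝ (Fin d) → ℝ}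

lemma isDualFeasible_cTransform [IsProbabilityMeasure μ] [Nonempty (Fin n)] (hq : ∀ i, 0 < q i)
    (hν : ν = ∑ i, ENNReal.ofReal (q i) • Measure.dirac (y i))
    (h2 : Integrable (fun x => ‖x‖ ^ 2) μ) (g : EuclideanSpace ℝ (Fin d) → ℝ) :
    IsDualFeasible μ ν (cTransform y fun i => g (y i)) g where
  integrable_left := integrable_cTransform y _ h2
  integrable_right := integrable_of_atomic hν g
  le_cost := by
    have h : ∀ᵐ z ∂ν, ∃ i, z = y i := (ae_of_atomic hν hq).2 fun i => ⟨i, rfl⟩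
    filter_upwards [Measure.quasiMeasurePreserving_snd.ae h] with z hz
    obtain ⟨i, hi⟩ := hz
    have := cTransform_le y (fun i => g (y i)) i z.1
    rw [reducedCost] at this
    rw [hi]
    linarith

lemma IsDualFeasible.le_cTransform [SFinite ν] [Nonempty (Fin n)] (hq : ∀ i, 0 < q i)
    (hν : ν = ∑ i, ENNReal.ofReal (q i) • Measure.dirac (y i)) (h : IsDualFeasible μ ν f g) :
    ∀ᵐ x ∂μ, f x ≤ cTransform y (fun i => g (y i)) x := by
  filter_upwards [Measure.ae_ae_of_ae_prod h.le_cost] with x hx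
  rw [ae_of_atomic hν hq] at hx
  refine le_ciInf fun i => ?_
  have := hx i
  rw [reducedCost]
  linarith

variable [IsProbabilityMeasure μ] [IsProbabilityMeasure ν]
  (hq : ∀ i, 0 < q i) (hν : ν = ∑ i, ENNReal.ofReal (q i) • Measure.dirac (y i))
  (h2 : Integrable (fun x => ‖x‖ ^ 2) μ) (h : IsOptimalPotentials μ ν f g)

include hq hν h2 h

lemma IsOptimalPotentials.integral_left_le [Nonempty (Fin n)] :
    ∫ x, f x ∂μ ≤ ∫ x, cTransform y (fun i => g (y i)) x ∂μ :=
  integral_mono_ae h.feasible.integrable_left (integrable_cTransform y _ h2)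
    (h.feasible.le_cTransform hq hν)

/-- Every atom receives at most the mass of its cell. -/
lemma IsOptimalPotentials.weight_le [Nonempty (Fin n)] (hy : Function.Injective y) (i : Fin n) :
    q i ≤ μ.real (powerCell y (fun i => g (y i)) i) := by
  classical
  set G : Fin n → ℝ := fun i => g (y i) with hG
  have hle : ∀ t : ℝ, 0 < t →
      q i ≤ μ.real {x | reducedCost y G i x - t ≤ cTransform y G x} := by
    intro t ht
    set A := {x | reducedCost y G i x - t ≤ cTransform y G x} with hA
    have hAm : MeasurableSet A := measurableSet_le
      ((continuous_reducedCost y G i).measurable.sub_const t) (measurable_cTransform y G)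
    -- Raising the potential at `y i` by `t` gains `t * q i`, while the c-transform drops by at most
    -- `t`, and only on `A`. Optimality then compares `q i` with the mass of `A`.
    set g' : EuclideanSpace ℝ (Fin d) → ℝ := fun z => g z + if z = y i then t else 0 with hg'
    set G' : Fin n → ℝ := fun i => g' (y i) with hG'
    have hmax := h.isMax _ g' (isDualFeasible_cTransform hq hν h2 g')
    have hint : ∫ z, g' z ∂ν = ∫ z, g z ∂ν + q i * t := by
      rw [integral_of_atomic hν hq, integral_of_atomic hν hq]
      simp [hg', mul_add, Finset.sum_add_distrib, hy.eq_iff]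
    have hleft := h.integral_left_le hq hν h2
    have hpt : ∀ x, cTransform y G x - cTransform y G' x ≤ A.indicator (fun _ => t) x := by
      intro x
      obtain ⟨k, hk⟩ := exists_reducedCost_eq y G' x
      have hGk : G' k = G k + if k = i then t else 0 := by
        simp [hG', hg', hG, hy.eq_iff]
      have hred : reducedCost y G' k x = reducedCost y G k x - if k = i then t else 0 := by
        rw [reducedCost, reducedCost, hGk]; ring
      have hk2 := cTransform_le y G k x
      by_cases hx : x ∈ A
      · rw [Set.indicator_of_mem hx, ← hk, hred]
        split_ifs <;> linarith
      · rw [Set.indicator_of_notMem hx, ← hk, hred]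
        split_ifs with hki
        · subst hki
          have h4 : ¬ (reducedCost y G k x - t ≤ cTransform y G x) := hx
          linarith
        · linarith
    have hint2 : ∫ x, cTransform y G x ∂μ - ∫ x, cTransform y G' x ∂μ ≤ t * μ.real A := by
      rw [← integral_sub (integrable_cTransform y G h2) (integrable_cTransform y G' h2)]
      refine (integral_mono ((integrable_cTransform y G h2).sub (integrable_cTransform y G' h2))
        ((integrable_const t).indicator hAm) hpt).trans_eq ?_
      rw [integral_indicator_const _ hAm, smul_eq_mul, mul_comm]
    have : t * q i ≤ t * μ.real A := by linarith
    exact le_of_mul_le_mul_left this ht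
  -- As `t = 1 / (k + 1)` tends to `0`, the enlarged cells decrease to the cell itself.
  have hanti : Antitone fun k : ℕ =>
      {x | reducedCost y G i x - 1 / ((k : ℝ) + 1) ≤ cTransform y G x} := by
    intro k l hkl x hx
    have h1 : (1 : ℝ) / ((l : ℝ) + 1) ≤ 1 / ((k : ℝ) + 1) := Nat.one_div_le_one_div hkl
    change reducedCost y G i x - 1 / ((k : ℝ) + 1) ≤ cTransform y G x
    have h3 : reducedCost y G i x - 1 / ((l : ℝ) + 1) ≤ cTransform y G x := hx
    linarith
  have hInter : ⋂ k : ℕ, {x | reducedCost y G i x - 1 / ((k : ℝ) + 1) ≤ cTransform y G x} =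
      powerCell y G i := by
    ext x
    rw [mem_powerCell_iff_reducedCost_eq, Set.mem_iInter]
    constructor
    · intro hx
      refine le_antisymm ?_ (cTransform_le y G i x)
      have hlim : Tendsto (fun k : ℕ => reducedCost y G i x - 1 / ((k : ℝ) + 1)) atTop
          (𝓝 (reducedCost y G i x - 0)) :=
        tendsto_const_nhds.sub tendsto_one_div_add_atTop_nhds_zero_nat
      rw [sub_zero] at hlim
      exact le_of_tendsto' hlim hx
    · intro hx k
      change reducedCost y G i x - 1 / ((k : ℝ) + 1) ≤ cTransform y G x
      rw [hx]
      have : (0 : ℝ) < 1 / ((k : ℝ) + 1) := Nat.one_div_pos_of_nat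
      linarith
  have hlim := tendsto_measure_iInter_atTop (μ := μ) (fun k : ℕ => (measurableSet_le
      ((continuous_reducedCost y G i).measurable.sub_const (1 / ((k : ℝ) + 1)))
      (measurable_cTransform y G)).nullMeasurableSet) hanti ⟨0, measure_ne_top _ _⟩
  rw [hInter] at hlim
  exact ge_of_tendsto' ((ENNReal.tendsto_toReal (measure_ne_top _ _)).comp hlim)
    fun k => hle _ Nat.one_div_pos_of_nat

/-- The cells cover the space with null overlaps, so both sides of `weight_le` sum to `1` and every
inequality is an equality. -/
lemma IsOptimalPotentials.measureReal_powerCell [Nonempty (Fin n)] (hy : Function.Injective y)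
    (hac : μ ≪ volume) (i : Fin n) : μ.real (powerCell y (fun i => g (y i)) i) = q i := by
  set G : Fin n → ℝ := fun i => g (y i) with hG
  have hsum : ∑ i, (μ.real (powerCell y G i) - q i) = 0 := by
    have h1 := integral_eq_sum_powerCell G hy hac (integrable_const (1 : ℝ))
    rw [Finset.sum_sub_distrib, sum_weights_eq_one hν hq]
    simp only [integral_const, probReal_univ, smul_eq_mul, mul_one, measureReal_restrict_apply,
      MeasurableSet.univ, Set.univ_inter] at h1
    linarith
  have := (Finset.sum_eq_zero_iff_of_nonneg fun i _ =>
    sub_nonneg.2 (h.weight_le hq hν h2 hy i)).1 hsum i (Finset.mem_univ i)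
  linarith

end Potentials

/-! ## The Gibbs variational principle -/

section Gibbs

open InformationTheory

variable {Ω : Type*} [MeasurableSpace Ω] {ρ γ : Measure Ω} [IsProbabilityMeasure ρ]
  {ξ : Ω → ℝ}

/-- This is nonnegativity of the divergence of `γ` from `ρ.tilted ξ`; the normalization `hone`
removes the log-partition term. -/
lemma integral_le_toReal_klDiv [IsProbabilityMeasure γ]
    (hexp : Integrable (fun z => Real.exp (ξ z)) ρ)
    (hone : ∫ z, Real.exp (ξ z) ∂ρ = 1) (hξ : Integrable ξ γ) (hkl : klDiv γ ρ ≠ ∞) :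
    ∫ z, ξ z ∂γ ≤ (klDiv γ ρ).toReal := by
  obtain ⟨hac, hllr⟩ := klDiv_ne_top_iff.1 hkl
  have := isProbabilityMeasure_tilted hexp
  have h0 := integral_llr_add_sub_measure_univ_nonneg
    (hac.trans (absolutelyContinuous_tilted hexp)) (integrable_llr_tilted_right hac hξ hllr hexp)
  rw [integral_llr_tilted_right hac hξ hexp hllr, hone, Real.log_one] at h0
  rw [toReal_klDiv_of_measure_eq hac (by simp)]
  simp only [probReal_univ] at h0
  linarith

/-- The equality case of the Gibbs inequality: the log-likelihood ratio is `ξ` itself. -/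
lemma klDiv_tilted (hexp : Integrable (fun z => Real.exp (ξ z)) ρ)
    (hone : ∫ z, Real.exp (ξ z) ∂ρ = 1) (hξ : Integrable ξ (ρ.tilted ξ)) :
    klDiv (ρ.tilted ξ) ρ ≠ ∞ ∧ (klDiv (ρ.tilted ξ) ρ).toReal = ∫ z, ξ z ∂(ρ.tilted ξ) := by
  have := isProbabilityMeasure_tilted hexp
  have hac := tilted_absolutelyContinuous ρ ξ
  have hllr : llr (ρ.tilted ξ) ρ =ᵐ[ρ.tilted ξ] ξ := by
    filter_upwards [hac.ae_le (log_rnDeriv_tilted_left_self hexp)] with z hz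
    rw [llr, hz, hone, Real.log_one, sub_zero]
  refine ⟨klDiv_ne_top hac ((integrable_congr hllr).2 hξ), ?_⟩
  rw [toReal_klDiv_of_measure_eq hac (by simp), integral_congr_ae hllr]

end Gibbs

/-! ## Couplings -/

section Couplings

variable {d : ℕ} {μ ν : Measure (EuclideanSpace ℝ (Fin d))}
  {γ : Measure (EuclideanSpace ℝ (Fin d) × EuclideanSpace ℝ (Fin d))}

lemma isProbabilityMeasure_of_mem_couplings [IsProbabilityMeasure μ] (h : γ ∈ couplings μ ν) :
    IsProbabilityMeasure γ :=
  ⟨by rw [← Measure.fst_univ, h.1, measure_univ]⟩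

lemma integrable_comp_fst (h : γ ∈ couplings μ ν) {φ : EuclideanSpace ℝ (Fin d) → ℝ}
    (hφ : Integrable φ μ) : Integrable (fun z => φ z.1) γ := by
  rw [← h.1] at hφ
  exact hφ.comp_measurable measurable_fst

lemma integrable_comp_snd (h : γ ∈ couplings μ ν) {φ : EuclideanSpace ℝ (Fin d) → ℝ}
    (hφ : Integrable φ ν) : Integrable (fun z => φ z.2) γ := by
  rw [← h.2] at hφ
  exact hφ.comp_measurable measurable_snd

lemma integral_comp_fst (h : γ ∈ couplings μ ν) {φ : EuclideanSpace ℝ (Fin d) → ℝ}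
    (hφ : Integrable φ μ) : ∫ z, φ z.1 ∂γ = ∫ x, φ x ∂μ := by
  rw [← h.1] at hφ ⊢
  exact (integral_map measurable_fst.aemeasurable hφ.1).symm

lemma integral_comp_snd (h : γ ∈ couplings μ ν) {φ : EuclideanSpace ℝ (Fin d) → ℝ}
    (hφ : Integrable φ ν) : ∫ z, φ z.2 ∂γ = ∫ x, φ x ∂ν := by
  rw [← h.2] at hφ ⊢
  exact (integral_map measurable_snd.aemeasurable hφ.1).symm

lemma integrable_cost (h : γ ∈ couplings μ ν) (hμ2 : Integrable (fun x => ‖x‖ ^ 2) μ)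
    (hν2 : Integrable (fun x => ‖x‖ ^ 2) ν) : Integrable (fun z => ‖z.1 - z.2‖ ^ 2) γ := by
  refine Integrable.mono' (((integrable_comp_fst h hμ2).const_mul 2).add
    ((integrable_comp_snd h hν2).const_mul 2)) (by fun_prop) (ae_of_all _ fun z => ?_)
  rw [Real.norm_of_nonneg (by positivity)]
  have h1 := norm_sub_le z.1 z.2
  have h3 := norm_nonneg (z.1 - z.2)
  simp only [Pi.add_apply]
  nlinarith [sq_nonneg (‖z.1‖ - ‖z.2‖)]

lemma transportCost_eq_ofReal (hc : Integrable (fun z => ‖z.1 - z.2‖ ^ 2) γ) :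
    transportCost γ = ENNReal.ofReal (∫ z, ‖z.1 - z.2‖ ^ 2 ∂γ) := by
  rw [ofReal_integral_eq_lintegral_ofReal hc (ae_of_all _ fun _ => by positivity), transportCost]
  refine lintegral_congr fun z => ?_
  rw [ENNReal.ofReal_pow (norm_nonneg _), ofReal_norm]

lemma entropicObjective_eq_ofReal {η : ℝ} (hη : 0 < η)
    (hc : Integrable (fun z => ‖z.1 - z.2‖ ^ 2) γ)
    (hkl : InformationTheory.klDiv γ (μ.prod ν) ≠ ∞) :
    entropicObjective μ ν η γ = ENNReal.ofReal (∫ z, ‖z.1 - z.2‖ ^ 2 ∂γ +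
      η⁻¹ * (InformationTheory.klDiv γ (μ.prod ν)).toReal) := by
  rw [entropicObjective, transportCost_eq_ofReal hc, ENNReal.ofReal_add
    (integral_nonneg fun _ => by positivity) (by positivity),
    ENNReal.ofReal_mul (inv_pos.2 hη).le, ENNReal.ofReal_toReal hkl]

end Couplings

/-! ## The entropic dual problem -/

section Dual

variable {d n : ℕ} (y : Fin n → EuclideanSpace ℝ (Fin d)) (g : Fin n → ℝ) (η : ℝ)

/-- The scores `δ_j - η (‖x - y_j‖² - g_j)`. -/
noncomputable def score (δ : Fin n → ℝ) (x : EuclideanSpace ℝ (Fin d)) : Fin n → ℝ :=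
  fun j => δ j - η * reducedCost y g j x

lemma continuous_score (δ : Fin n → ℝ) : Continuous (score y g η δ) := by
  have := continuous_reducedCost y g
  unfold score
  fun_prop

lemma continuous_logSumExp_score [Nonempty (Fin n)] (δ : Fin n → ℝ) :
    Continuous fun x => logSumExp (score y g η δ x) := by
  have := continuous_score y g η δ
  unfold logSumExp
  exact Continuous.log (by fun_prop) fun x => (sum_exp_pos (Classical.arbitrary _) _).ne'

lemma exp_score_sub_le_one (δ : Fin n → ℝ) (i : Fin n) (x : EuclideanSpace ℝ (Fin d)) :
    Real.exp (score y g η δ x i - logSumExp (score y g η δ x)) ≤ 1 := by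
  rw [Real.exp_le_one_iff]
  linarith [le_logSumExp (score y g η δ x) i]

variable {μ : Measure (EuclideanSpace ℝ (Fin d))} [IsProbabilityMeasure μ]

lemma integrable_score (h2 : Integrable (fun x => ‖x‖ ^ 2) μ) (δ : Fin n → ℝ) (j : Fin n) :
    Integrable (fun x => score y g η δ x j) μ :=
  (integrable_const _).sub ((integrable_reducedCost y g h2 j).const_mul η)

variable [Nonempty (Fin n)]

lemma integrable_logSumExp_score (h2 : Integrable (fun x => ‖x‖ ^ 2) μ) (δ : Fin n → ℝ) :
    Integrable (fun x => logSumExp (score y g η δ x)) μ := by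
  have i₀ : Fin n := Classical.arbitrary _
  refine Integrable.mono' ((integrable_const |logSumExp (0 : Fin n → ℝ)|).add
    (integrable_finsetSum Finset.univ fun j _ => (integrable_score y g η h2 δ j).norm))
    (continuous_logSumExp_score y g η δ).aestronglyMeasurable (ae_of_all _ fun x => ?_)
  have hsum : ∀ i, ‖score y g η δ x i‖ ≤ ∑ j, ‖score y g η δ x j‖ := fun i =>
    Finset.single_le_sum (f := fun j => ‖score y g η δ x j‖) (fun _ _ => norm_nonneg _)
      (Finset.mem_univ i)
  have hnorm : ‖score y g η δ x‖ ≤ ∑ j, ‖score y g η δ x j‖ :=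
    (pi_norm_le_iff_of_nonneg (Finset.sum_nonneg fun _ _ => norm_nonneg _)).2 hsum
  have hup := logSumExp_le_add_norm i₀ (score y g η δ x) 0
  have hlow := le_logSumExp (score y g η δ x) i₀
  have h1 := neg_abs_le (score y g η δ x i₀)
  have h2 := hsum i₀
  have h3 := le_abs_self (logSumExp (0 : Fin n → ℝ))
  have h4 := abs_nonneg (logSumExp (0 : Fin n → ℝ))
  rw [sub_zero] at hup
  rw [Real.norm_eq_abs] at h2 ⊢
  simp only [Pi.add_apply]
  exact abs_le.2 ⟨by linarith, by linarith⟩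

/-- The integral of the log-sum-exp of the scores. -/
noncomputable def integratedLogSumExp (μ : Measure (EuclideanSpace ℝ (Fin d)))
    (δ : Fin n → ℝ) : ℝ := ∫ x, logSumExp (score y g η δ x) ∂μ

lemma integratedLogSumExp_le_add_dist (h2 : Integrable (fun x => ‖x‖ ^ 2) μ)
    (δ δ' : Fin n → ℝ) : integratedLogSumExp y g η μ δ ≤
      integratedLogSumExp y g η μ δ' + dist δ δ' := by
  have i₀ : Fin n := Classical.arbitrary _
  have hint : ∫ x, (logSumExp (score y g η δ' x) + dist δ δ') ∂μ =
      integratedLogSumExp y g η μ δ' + dist δ δ' := by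
    rw [integral_add (integrable_logSumExp_score y g η h2 δ') (integrable_const _)]
    simp [integratedLogSumExp]
  rw [← hint]
  refine integral_mono (integrable_logSumExp_score y g η h2 δ)
    ((integrable_logSumExp_score y g η h2 δ').add (integrable_const _)) fun x => ?_
  have h := logSumExp_le_add_norm i₀ (score y g η δ x) (score y g η δ' x)
  have hs : score y g η δ x - score y g η δ' x = δ - δ' := by
    ext j; simp [score]
  rwa [hs, ← dist_eq_norm] at h

lemma continuous_integratedLogSumExp (h2 : Integrable (fun x => ‖x‖ ^ 2) μ) :
    Continuous (integratedLogSumExp y g η μ) :=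
  (LipschitzWith.of_le_add (integratedLogSumExp_le_add_dist y g η h2)).continuous

variable {q : Fin n → ℝ}

/-- Compactness: log-sum-exp dominates every score, so a bound on `F` bounds each `δ i` above, and
the constraint `∑ q_i δ_i = 0` then bounds it below. -/
lemma exists_minimizer_integratedLogSumExp (h2 : Integrable (fun x => ‖x‖ ^ 2) μ)
    (hq : ∀ i, 0 < q i) (hq1 : ∑ i, q i = 1) :
    ∃ δ : Fin n → ℝ, ∑ i, q i * δ i = 0 ∧ ∀ δ' : Fin n → ℝ, ∑ i, q i * δ' i = 0 →
      integratedLogSumExp y g η μ δ ≤ integratedLogSumExp y g η μ δ' := by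
  set F := integratedLogSumExp y g η μ with hF
  have hFc : Continuous F := continuous_integratedLogSumExp y g η h2
  set b : Fin n → ℝ := fun i => F 0 + η * ∫ x, reducedCost y g i x ∂μ with hb
  set B := ∑ i, |b i| with hB
  have hB0 : 0 ≤ B := Finset.sum_nonneg fun _ _ => abs_nonneg _
  set K : Set (Fin n → ℝ) := {δ | ∑ i, q i * δ i = 0} ∩ {δ | F δ ≤ F 0} with hK
  have hKclosed : IsClosed K :=
    (isClosed_eq (by fun_prop) continuous_const).inter (isClosed_le hFc continuous_const)
  have hKsub : K ⊆ Set.Icc (fun i => -B / q i) (fun _ => B) := by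
    rintro δ ⟨h0, hle⟩
    have h0 : ∑ i, q i * δ i = 0 := h0
    have hle : F δ ≤ F 0 := hle
    have hup : ∀ i, δ i ≤ B := by
      intro i
      have h1 : ∫ x, score y g η δ x i ∂μ ≤ F δ :=
        integral_mono (integrable_score y g η h2 δ i) (integrable_logSumExp_score y g η h2 δ)
          fun x => le_logSumExp _ i
      have h3 : ∫ x, score y g η δ x i ∂μ = δ i - η * ∫ x, reducedCost y g i x ∂μ := by
        unfold score
        rw [integral_sub (integrable_const _) ((integrable_reducedCost y g h2 i).const_mul η),
          integral_const_mul]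
        simp
      have h4 : |b i| ≤ B := Finset.single_le_sum (f := fun i => |b i|)
        (fun _ _ => abs_nonneg _) (Finset.mem_univ i)
      have h5 := le_abs_self (b i)
      simp only [hb] at h4 h5
      linarith
    refine ⟨fun i => ?_, hup⟩
    change -B / q i ≤ δ i
    rw [div_le_iff₀ (hq i)]
    have h6 := Finset.add_sum_erase Finset.univ (fun i => q i * δ i) (Finset.mem_univ i)
    have h7 := Finset.add_sum_erase Finset.univ q (Finset.mem_univ i)
    have h8 : ∑ j ∈ Finset.univ.erase i, q j * δ j ≤ (∑ j ∈ Finset.univ.erase i, q j) * B := by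
      rw [Finset.sum_mul]
      exact Finset.sum_le_sum fun j _ => mul_le_mul_of_nonneg_left (hup j) (hq j).le
    nlinarith [hq i]
  have hKc : IsCompact K := isCompact_Icc.of_isClosed_subset hKclosed hKsub
  obtain ⟨δ, hδ, hmin⟩ := hKc.exists_isMinOn ⟨0, by simp [hK]⟩ hFc.continuousOn
  refine ⟨δ, hδ.1, fun δ' hδ' => ?_⟩
  by_cases hle : F δ' ≤ F 0
  · exact hmin ⟨hδ', hle⟩
  · exact le_trans hδ.2 (not_le.1 hle).le

lemma integrable_exp_score_sub (δ : Fin n → ℝ) (i : Fin n) :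
    Integrable (fun x => Real.exp (score y g η δ x i - logSumExp (score y g η δ x))) μ := by
  have h1 := continuous_score y g η δ
  have h2 := continuous_logSumExp_score y g η δ
  refine Integrable.of_bound (by fun_prop) 1 (ae_of_all _ fun x => ?_)
  rw [Real.norm_of_nonneg (Real.exp_pos _).le]
  exact exp_score_sub_le_one y g η δ i x

variable {y g η} in
/-- The first-order condition at a minimizer. -/
lemma integral_exp_score_sub_eq (h2 : Integrable (fun x => ‖x‖ ^ 2) μ) (hq1 : ∑ i, q i = 1)
    {δ : Fin n → ℝ} (hδ : ∑ i, q i * δ i = 0)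
    (hmin : ∀ δ' : Fin n → ℝ, ∑ i, q i * δ' i = 0 →
      integratedLogSumExp y g η μ δ ≤ integratedLogSumExp y g η μ δ') (i : Fin n) :
    ∫ x, Real.exp (score y g η δ x i - logSumExp (score y g η δ x)) ∂μ = q i := by
  set A := ∫ x, Real.exp (score y g η δ x i - logSumExp (score y g η δ x)) ∂μ with hA
  have hnonneg : ∀ t : ℝ, 0 ≤ A * (Real.exp t - 1) - t * q i := by
    intro t
    -- The constant shift restores the constraint, and log-sum-exp commutes with it.
    set δ' : Fin n → ℝ := fun j => (δ j + if j = i then t else 0) + -(t * q i) with hδ'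
    have h0 : ∑ j, q j * δ' j = 0 := by
      simp only [hδ', mul_add, Finset.sum_add_distrib, hδ, mul_ite, mul_zero, Finset.sum_ite_eq',
        Finset.mem_univ, if_true, ← Finset.sum_mul, hq1]
      ring
    have hpt : ∀ x, logSumExp (score y g η δ' x) ≤ (logSumExp (score y g η δ x) +
        Real.exp (score y g η δ x i - logSumExp (score y g η δ x)) * (Real.exp t - 1)) +
          -(t * q i) := by
      intro x
      have hs : score y g η δ' x =
          fun j => (score y g η δ x j + if j = i then t else 0) + -(t * q i) := by
        ext j; simp only [score, hδ']; ring
      rw [hs, logSumExp_add_const i]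
      exact add_le_add_left (logSumExp_perturb_le (score y g η δ x) i t) _
    have hI1 := integrable_logSumExp_score y g η h2 δ
    have hI2 := (integrable_exp_score_sub y g η (μ := μ) δ i).mul_const (Real.exp t - 1)
    have hle : integratedLogSumExp y g η μ δ' ≤
        integratedLogSumExp y g η μ δ + A * (Real.exp t - 1) + -(t * q i) := by
      refine (integral_mono (integrable_logSumExp_score y g η h2 δ')
        ((hI1.add hI2).add (integrable_const _)) hpt).trans_eq ?_
      rw [integral_add' (hI1.add hI2) (integrable_const _), integral_add' hI1 hI2,
        integral_mul_const, ← hA]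
      simp [integratedLogSumExp]
    linarith [hmin δ' h0]
  have hderiv : HasDerivAt (fun t : ℝ => A * (Real.exp t - 1) - t * q i) (A - q i) 0 := by
    have h1 : HasDerivAt (fun t : ℝ => A * (Real.exp t - 1) - t * q i)
        (A * Real.exp 0 - 1 * q i) 0 :=
      (((Real.hasDerivAt_exp 0).sub_const 1).const_mul A).sub
        ((hasDerivAt_id (0 : ℝ)).mul_const (q i))
    simpa using h1
  -- A nonnegative function vanishing at `t = 0` has derivative `0` there.
  have hloc : IsLocalMin (fun t : ℝ => A * (Real.exp t - 1) - t * q i) 0 :=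
    Eventually.of_forall fun t => by simpa using hnonneg t
  have := hloc.hasDerivAt_eq_zero hderiv
  linarith

end Dual

/-! ## Duality for the entropic problem -/

section EntropicDuality

open InformationTheory

variable {d n : ℕ} {μ ν : Measure (EuclideanSpace ℝ (Fin d))}
  {y : Fin n → EuclideanSpace ℝ (Fin d)} {q g : Fin n → ℝ} {η : ℝ}

/-- The logarithm of the density, with respect to `μ ⊗ ν`, of the plan with the conditional
probabilities `exp (score_i(x)) / ∑ j, exp (score_j(x))`. -/
noncomputable def logDensity (y : Fin n → EuclideanSpace ℝ (Fin d)) (q g : Fin n → ℝ) (η : ℝ)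
    (δ : Fin n → ℝ) (z : EuclideanSpace ℝ (Fin d) × EuclideanSpace ℝ (Fin d)) : ℝ :=
  Function.extend y (fun i => δ i + η * g i - Real.log (q i)) 0 z.2 - η * ‖z.1 - z.2‖ ^ 2 - logSumExp (score y g η δ z.1)

lemma logDensity_atom (hy : Function.Injective y) (δ : Fin n → ℝ) (x : EuclideanSpace ℝ (Fin d))
    (i : Fin n) : logDensity y q g η δ (x, y i) =
      score y g η δ x i - logSumExp (score y g η δ x) - Real.log (q i) := by
  rw [logDensity, hy.extend_apply, score, reducedCost]
  ring

lemma measurable_logDensity [Nonempty (Fin n)] (δ : Fin n → ℝ) :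
    Measurable (logDensity y q g η δ) := by
  have h1 : Measurable (Function.extend y (fun i => δ i + η * g i - Real.log (q i)) 0) :=
    measurable_of_measurable_on_compl_finite _ (Set.finite_range y) <| by
      have : (Set.range y)ᶜ.domRestrict
          (Function.extend y (fun i => δ i + η * g i - Real.log (q i)) 0) = fun _ => 0 := by
        ext z
        exact Function.extend_apply' _ _ _ z.2
      rw [this]
      exact measurable_const
  have h2 := (continuous_logSumExp_score y g η δ).measurable
  exact ((h1.comp measurable_snd).sub (by fun_prop)).sub (h2.comp measurable_fst)

/-- The term `-log (q i)` cancels the mass of the atom under `ν`, leaving the softmax probability.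
-/
lemma exp_logDensity_atom (hy : Function.Injective y) (hq : ∀ i, 0 < q i) (δ : Fin n → ℝ)
    (x : EuclideanSpace ℝ (Fin d)) (i : Fin n) :
    ENNReal.ofReal (q i) * ENNReal.ofReal (Real.exp (logDensity y q g η δ (x, y i))) =
      ENNReal.ofReal (Real.exp (score y g η δ x i - logSumExp (score y g η δ x))) := by
  rw [← ENNReal.ofReal_mul (hq i).le, logDensity_atom hy, Real.exp_sub _ (Real.log _),
    Real.exp_log (hq i), mul_div_cancel₀ _ (hq i).ne']

variable [Nonempty (Fin n)]

lemma sum_exp_score_sub (δ : Fin n → ℝ) (x : EuclideanSpace ℝ (Fin d)) :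
    ∑ i, ENNReal.ofReal (Real.exp (score y g η δ x i - logSumExp (score y g η δ x))) = 1 := by
  have hS := sum_exp_pos (Classical.arbitrary (Fin n)) (score y g η δ x)
  rw [← ENNReal.ofReal_sum_of_nonneg fun _ _ => (Real.exp_pos _).le]
  simp_rw [Real.exp_sub, ← Finset.sum_div]
  rw [logSumExp, Real.exp_log hS, div_self hS.ne', ENNReal.ofReal_one]

lemma integrable_logDensity [IsProbabilityMeasure μ]
    (hν : ν = ∑ i, ENNReal.ofReal (q i) • Measure.dirac (y i))
    (h2 : Integrable (fun x => ‖x‖ ^ 2) μ) (δ : Fin n → ℝ)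
    {γ : Measure (EuclideanSpace ℝ (Fin d) × EuclideanSpace ℝ (Fin d))} (hγ : γ ∈ couplings μ ν) :
    Integrable (logDensity y q g η δ) γ :=
  ((integrable_comp_snd hγ (integrable_of_atomic hν _)).sub
    ((integrable_cost hγ h2 (integrable_of_atomic hν _)).const_mul η)).sub
    (integrable_comp_fst hγ (integrable_logSumExp_score y g η h2 δ))

variable [IsProbabilityMeasure μ] [IsProbabilityMeasure ν]
  (hy : Function.Injective y) (hq : ∀ i, 0 < q i)
  (hν : ν = ∑ i, ENNReal.ofReal (q i) • Measure.dirac (y i))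

include hy hq hν

omit [IsProbabilityMeasure μ] in
lemma lintegral_exp_logDensity_mul (δ : Fin n → ℝ)
    {φ : EuclideanSpace ℝ (Fin d) × EuclideanSpace ℝ (Fin d) → ℝ≥0∞} (hφ : Measurable φ) :
    ∫⁻ z, φ z * ENNReal.ofReal (Real.exp (logDensity y q g η δ z)) ∂(μ.prod ν) =
      ∫⁻ x, ∑ i, φ (x, y i) *
        ENNReal.ofReal (Real.exp (score y g η δ x i - logSumExp (score y g η δ x))) ∂μ := by
  have hm : Measurable (logDensity y q g η δ) := measurable_logDensity δ
  rw [lintegral_prod _ (by fun_prop)]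
  refine lintegral_congr fun x => ?_
  rw [lintegral_of_atomic hν]
  refine Finset.sum_congr rfl fun i _ => ?_
  rw [mul_left_comm, exp_logDensity_atom hy hq]

lemma lintegral_exp_logDensity (δ : Fin n → ℝ) :
    ∫⁻ z, ENNReal.ofReal (Real.exp (logDensity y q g η δ z)) ∂(μ.prod ν) = 1 := by
  have h := lintegral_exp_logDensity_mul (μ := μ) (g := g) (η := η) hy hq hν δ
    (measurable_const (a := (1 : ℝ≥0∞)))
  simp only [one_mul, sum_exp_score_sub, lintegral_const, measure_univ] at h
  exact h

lemma integrable_exp_logDensity (δ : Fin n → ℝ) :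
    Integrable (fun z => Real.exp (logDensity y q g η δ z)) (μ.prod ν) := by
  have hm : Measurable (logDensity y q g η δ) := measurable_logDensity δ
  refine ⟨by fun_prop, ?_⟩
  rw [hasFiniteIntegral_iff_ofReal (ae_of_all _ fun _ => (Real.exp_pos _).le),
    lintegral_exp_logDensity hy hq hν]
  exact ENNReal.one_lt_top

lemma integral_exp_logDensity (δ : Fin n → ℝ) :
    ∫ z, Real.exp (logDensity y q g η δ z) ∂(μ.prod ν) = 1 := by
  rw [integral_eq_lintegral_of_nonneg_ae (ae_of_all _ fun _ => (Real.exp_pos _).le)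
    (integrable_exp_logDensity hy hq hν δ).1, lintegral_exp_logDensity hy hq hν, ENNReal.toReal_one]

/-- The first marginal is right because the softmax probabilities sum to one at every `x`; the
second is exactly the first-order condition. -/
lemma tilted_logDensity_mem_couplings {δ : Fin n → ℝ}
    (hfirst : ∀ i, ∫ x, Real.exp (score y g η δ x i - logSumExp (score y g η δ x)) ∂μ = q i) :
    (μ.prod ν).tilted (logDensity y q g η δ) ∈ couplings μ ν := by
  have happly : ∀ s, MeasurableSet s → (μ.prod ν).tilted (logDensity y q g η δ) s =
      ∫⁻ x, ∑ i, s.indicator 1 (x, y i) *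
        ENNReal.ofReal (Real.exp (score y g η δ x i - logSumExp (score y g η δ x))) ∂μ := by
    intro s hs
    rw [tilted_apply' _ _ hs, integral_exp_logDensity hy hq hν,
      ← lintegral_exp_logDensity_mul hy hq hν δ (measurable_one.indicator hs),
      ← lintegral_indicator hs]
    refine lintegral_congr fun z => ?_
    by_cases hz : z ∈ s <;> simp [hz]
  constructor
  · ext s hs
    rw [Measure.fst_apply hs, happly _ (measurable_fst hs), ← lintegral_indicator_one hs]
    refine lintegral_congr fun x => ?_
    by_cases hx : x ∈ s
    · simp [hx, sum_exp_score_sub]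
    · simp [hx]
  · ext s hs
    have hsm : ∀ i, Measurable fun x => ENNReal.ofReal
        (Real.exp (score y g η δ x i - logSumExp (score y g η δ x))) := fun i => by
      have h1 := (continuous_score y g η δ).measurable
      have h2 := (continuous_logSumExp_score y g η δ).measurable
      fun_prop
    rw [Measure.snd_apply hs, happly _ (measurable_snd hs), ← lintegral_indicator_one hs,
      lintegral_of_atomic hν, lintegral_finsetSum _ fun i _ => by
        have := hsm i
        refine Measurable.mul ?_ this
        by_cases hi : y i ∈ s <;> simp [hi]]
    refine Finset.sum_congr rfl fun i _ => ?_
    rw [← hfirst i, ofReal_integral_eq_lintegral_ofReal (integrable_exp_score_sub y g η δ i)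
      (ae_of_all _ fun _ => (Real.exp_pos _).le)]
    by_cases hi : y i ∈ s <;> simp [hi]

variable (h2 : Integrable (fun x => ‖x‖ ^ 2) μ)
include h2

-- Apart from the quadratic cost, the log-density splits into functions of one variable, whose
-- integrals depend only on the marginals.
omit [IsProbabilityMeasure ν] in
lemma integral_logDensity (hg : ∑ i, q i * g i = 0) {δ : Fin n → ℝ} (hδ : ∑ i, q i * δ i = 0)
    {γ : Measure (EuclideanSpace ℝ (Fin d) × EuclideanSpace ℝ (Fin d))} (hγ : γ ∈ couplings μ ν) :
    ∫ z, logDensity y q g η δ z ∂γ =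
      shannonEntropy q - η * ∫ z, ‖z.1 - z.2‖ ^ 2 ∂γ - integratedLogSumExp y g η μ δ := by
  have hI1 := integrable_comp_snd hγ (integrable_of_atomic hν
    (Function.extend y (fun i => δ i + η * g i - Real.log (q i)) 0))
  have hI2 := (integrable_cost hγ h2 (integrable_of_atomic hν _)).const_mul η
  have hI3 := integrable_comp_fst hγ (integrable_logSumExp_score y g η h2 δ)
  have hI12 : Integrable (fun z : EuclideanSpace ℝ (Fin d) × EuclideanSpace ℝ (Fin d) =>
      Function.extend y (fun i => δ i + η * g i - Real.log (q i)) 0 z.2 -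
        η * ‖z.1 - z.2‖ ^ 2) γ := hI1.sub hI2
  unfold logDensity
  rw [integral_sub hI12 hI3, integral_sub hI1 hI2, integral_const_mul,
    integral_comp_fst hγ (integrable_logSumExp_score y g η h2 δ),
    integral_comp_snd hγ (integrable_of_atomic hν _), integral_of_atomic hν hq]
  have hsum : ∑ i, q i *
      Function.extend y (fun i => δ i + η * g i - Real.log (q i)) 0 (y i) = shannonEntropy q := by
    have h1 : ∀ i, q i * Function.extend y (fun i => δ i + η * g i - Real.log (q i)) 0 (y i) =
        q i * δ i + η * (q i * g i) - q i * Real.log (q i) := fun i => by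
      rw [hy.extend_apply]; ring
    simp_rw [h1, Finset.sum_sub_distrib, Finset.sum_add_distrib, ← Finset.mul_sum, hδ, hg,
      shannonEntropy]
    ring
  rw [hsum, integratedLogSumExp]

/-- The cost of the entropic plan is given by the minimum of the dual problem. -/
lemma IsEntropicPlan.cost_eq (hη : 0 < η) (hg : ∑ i, q i * g i = 0) {δ : Fin n → ℝ}
    (hδ : ∑ i, q i * δ i = 0)
    (hfirst : ∀ i, ∫ x, Real.exp (score y g η δ x i - logSumExp (score y g η δ x)) ∂μ = q i)
    {γ : Measure (EuclideanSpace ℝ (Fin d) × EuclideanSpace ℝ (Fin d))}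
    (hγ : IsEntropicPlan μ ν η γ) :
    klDiv γ (μ.prod ν) ≠ ∞ ∧ ∫ z, ‖z.1 - z.2‖ ^ 2 ∂γ + η⁻¹ * (klDiv γ (μ.prod ν)).toReal =
      (shannonEntropy q - integratedLogSumExp y g η μ δ) / η := by
  have hexp : Integrable (fun z => Real.exp (logDensity y q g η δ z)) (μ.prod ν) :=
    integrable_exp_logDensity hy hq hν δ
  have hone : ∫ z, Real.exp (logDensity y q g η δ z) ∂(μ.prod ν) = 1 :=
    integral_exp_logDensity hy hq hν δ
  have hν2 : Integrable (fun x => ‖x‖ ^ 2) ν := integrable_of_atomic hν _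
  have hπ : (μ.prod ν).tilted (logDensity y q g η δ) ∈ couplings μ ν :=
    tilted_logDensity_mem_couplings hy hq hν hfirst
  set π := (μ.prod ν).tilted (logDensity y q g η δ) with hπdef
  obtain ⟨hπkl, hπeq⟩ := klDiv_tilted hexp hone (integrable_logDensity hν h2 δ hπ)
  rw [← hπdef] at hπkl hπeq
  rw [integral_logDensity hy hq hν h2 hg hδ hπ] at hπeq
  have hle := hγ.isMin π hπ
  have hcπ := integrable_cost hπ h2 hν2
  have hcγ := integrable_cost hγ.mem_couplings h2 hν2
  have hkl : klDiv γ (μ.prod ν) ≠ ∞ := by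
    intro htop
    rw [entropicObjective_eq_ofReal hη hcπ hπkl, entropicObjective, htop, ENNReal.mul_top
      (by simpa using hη), add_top] at hle
    exact ENNReal.ofReal_ne_top (top_le_iff.1 hle)
  refine ⟨hkl, ?_⟩
  rw [entropicObjective_eq_ofReal hη hcπ hπkl, entropicObjective_eq_ofReal hη hcγ hkl,
    ENNReal.ofReal_le_ofReal_iff (add_nonneg (integral_nonneg fun _ => by positivity)
      (by positivity)), hπeq] at hle
  have := isProbabilityMeasure_of_mem_couplings hγ.mem_couplings
  -- Gibbs bounds the objective of `γ` below by the dual value; minimality against `π`, where Gibbs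
  -- is an equality, bounds it above.
  have hgibbs := integral_le_toReal_klDiv hexp hone
    (integrable_logDensity hν h2 δ hγ.mem_couplings) hkl
  rw [integral_logDensity hy hq hν h2 hg hδ hγ.mem_couplings] at hgibbs
  rw [eq_div_iff hη.ne']
  have h1 : (∫ z, ‖z.1 - z.2‖ ^ 2 ∂γ + η⁻¹ * (klDiv γ (μ.prod ν)).toReal) * η =
      η * ∫ z, ‖z.1 - z.2‖ ^ 2 ∂γ + (klDiv γ (μ.prod ν)).toReal := by
    field_simp
  refine le_antisymm ?_ (by rw [h1]; linarith)
  refine (mul_le_mul_of_nonneg_right hle hη.le).trans_eq ?_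
  field_simp
  ring

end EntropicDuality

/-! ## The entropic cost and the auxiliary problem -/

section Value

open InformationTheory

variable {d n : ℕ} {μ ν : Measure (EuclideanSpace ℝ (Fin d))} [IsProbabilityMeasure μ]
  [IsProbabilityMeasure ν] [Nonempty (Fin n)]
  {y : Fin n → EuclideanSpace ℝ (Fin d)} {q : Fin n → ℝ} {g : Fin n → ℝ} {η : ℝ}

-- On `S_i` factor out the `i`-th score, which is `δ_i - η cTransform` there. The terms `δ_i` sum to
-- `∑ μ(S_i) δ_i = ∑ q_i δ_i = 0`.
omit [IsProbabilityMeasure ν] in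
lemma integratedLogSumExp_eq (hy : Function.Injective y) (hac : μ ≪ volume)
    (h2 : Integrable (fun x => ‖x‖ ^ 2) μ)
    (hcell : ∀ i, μ.real (powerCell y g i) = q i) {δ : Fin n → ℝ} (hδ : ∑ i, q i * δ i = 0)
    (hη : 0 ≤ η) :
    integratedLogSumExp y g η μ δ = auxObjective μ y g η δ - η * ∫ x, cTransform y g x ∂μ := by
  have hcT := integrable_cTransform y g h2
  rw [integratedLogSumExp, integral_eq_sum_powerCell g hy hac
    (integrable_logSumExp_score y g η h2 δ), integral_eq_sum_powerCell g hy hac hcT, auxObjective]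
  have hi : ∀ i, ∫ x in powerCell y g i, logSumExp (score y g η δ x) ∂μ =
      q i * δ i - η * ∫ x in powerCell y g i, cTransform y g x ∂μ +
      ∫ x in powerCell y g i, Real.log
        (1 + ∑ j ∈ Finset.univ.erase i, Real.exp (δ j - δ i - η * slack y g i j x)) ∂μ := by
    intro i
    have hpt : ∀ x ∈ powerCell y g i, logSumExp (score y g η δ x) =
        (δ i - η * cTransform y g x) + Real.log
          (1 + ∑ j ∈ Finset.univ.erase i, Real.exp (δ j - δ i - η * slack y g i j x)) := by
      intro x hx
      rw [logSumExp_eq _ i]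
      congr 1
      · rw [score, (mem_powerCell_iff_reducedCost_eq y g).1 hx]
      · congr 2
        refine Finset.sum_congr rfl fun j _ => ?_
        congr 1
        rw [score, score, slack_eq_reducedCost_sub]
        ring
    have hI : IntegrableOn (fun x => δ i - η * cTransform y g x) (powerCell y g i) μ :=
      (integrable_const _).sub (hcT.integrableOn.const_mul η)
    rw [setIntegral_congr_fun (measurableSet_powerCell y g i) hpt, integral_add hI
      (integrableOn_auxIntegrand hη i δ),
      integral_sub (integrable_const _) (hcT.integrableOn.const_mul η), integral_const_mul,
      setIntegral_const, hcell, smul_eq_mul]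
  simp_rw [hi, Finset.sum_add_distrib, Finset.sum_sub_distrib, hδ, ← Finset.mul_sum]
  ring

/-- The optimal entropic cost in terms of the value of the auxiliary problem. -/
lemma IsEntropicPlan.cost_eq_auxValue (hy : Function.Injective y) (hq : ∀ i, 0 < q i)
    (hν : ν = ∑ i, ENNReal.ofReal (q i) • Measure.dirac (y i)) (hac : μ ≪ volume)
    (h2 : Integrable (fun x => ‖x‖ ^ 2) μ)
    (hcell : ∀ i, μ.real (powerCell y g i) = q i) (hg : ∑ i, q i * g i = 0) (hη : 0 < η)
    {γ : Measure (EuclideanSpace ℝ (Fin d) × EuclideanSpace ℝ (Fin d))}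
    (hγ : IsEntropicPlan μ ν η γ) :
    klDiv γ (μ.prod ν) ≠ ∞ ∧ ∫ z, ‖z.1 - z.2‖ ^ 2 ∂γ + η⁻¹ * (klDiv γ (μ.prod ν)).toReal =
      ∫ x, cTransform y g x ∂μ + shannonEntropy q / η - auxValue μ y q g η / η := by
  have hq1 := sum_weights_eq_one hν hq
  obtain ⟨δ, hδ, hmin⟩ := exists_minimizer_integratedLogSumExp y g η h2 hq hq1
  obtain ⟨hkl, heq⟩ := hγ.cost_eq hy hq hν h2 hη hg hδ (integral_exp_score_sub_eq h2 hq1 hδ hmin)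
  refine ⟨hkl, ?_⟩
  -- On the constraint set the two objectives differ by a constant, so they share minimizers.
  have hval : auxValue μ y q g η = auxObjective μ y g η δ := by
    refine le_antisymm (auxValue_le η hδ) (le_auxValue fun δ' hδ' => ?_)
    have := hmin δ' hδ'
    rw [integratedLogSumExp_eq hy hac h2 hcell hδ hη.le,
      integratedLogSumExp_eq hy hac h2 hcell hδ' hη.le] at this
    linarith
  rw [heq, integratedLogSumExp_eq hy hac h2 hcell hδ hη.le, hval]
  field_simp
  ring

end Value

/-! ## The unregularized cost -/

section Wasserstein

variable {d n : ℕ} {μ ν : Measure (EuclideanSpace ℝ (Fin d))} [IsProbabilityMeasure μ]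
  [Nonempty (Fin n)] {y : Fin n → EuclideanSpace ℝ (Fin d)} {q : Fin n → ℝ}
  {g : EuclideanSpace ℝ (Fin d) → ℝ}

/-- Weak duality: integrate `cTransform x + g z ≤ ‖x - z‖²`, valid at the atoms `z`, against an
arbitrary coupling. -/
lemma ofReal_integral_cTransform_le (hq : ∀ i, 0 < q i)
    (hν : ν = ∑ i, ENNReal.ofReal (q i) • Measure.dirac (y i))
    (h2 : Integrable (fun x => ‖x‖ ^ 2) μ) (hg : ∫ z, g z ∂ν = 0) :
    ENNReal.ofReal (∫ x, cTransform y (fun i => g (y i)) x ∂μ) ≤ wassersteinSq μ ν := by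
  refine le_iInf₂ fun γ hγ => ?_
  have hc := integrable_cost hγ h2 (integrable_of_atomic hν _)
  have hcT := integrable_cTransform y (fun i => g (y i)) h2
  have hgν := integrable_of_atomic hν g
  rw [transportCost_eq_ofReal hc]
  refine ENNReal.ofReal_le_ofReal ?_
  have h : ∀ᵐ z ∂γ, ∃ i, z.2 = y i := by
    have h1 : ∀ᵐ z ∂ν, ∃ i, z = y i := (ae_of_atomic hν hq).2 fun i => ⟨i, rfl⟩
    rw [← hγ.2] at h1
    exact ae_of_ae_map measurable_snd.aemeasurable h1
  calc ∫ x, cTransform y (fun i => g (y i)) x ∂μ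
      = ∫ z, (cTransform y (fun i => g (y i)) z.1 + g z.2) ∂γ := by
        rw [integral_add (integrable_comp_fst hγ hcT) (integrable_comp_snd hγ hgν),
          integral_comp_fst hγ hcT, integral_comp_snd hγ hgν, hg, add_zero]
    _ ≤ ∫ z, ‖z.1 - z.2‖ ^ 2 ∂γ := by
        refine integral_mono_ae ((integrable_comp_fst hγ hcT).add (integrable_comp_snd hγ hgν)) hc
          ?_
        filter_upwards [h] with z hz
        obtain ⟨i, hi⟩ := hz
        have := cTransform_le y (fun i => g (y i)) i z.1
        rw [reducedCost] at this
        rw [hi]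
        linarith

end Wasserstein

/-! ## Second moments -/

section SecondMoment

variable {d : ℕ} {μ : Measure (EuclideanSpace ℝ (Fin d))}

lemma integrable_norm_sq_of_lintegral (h : ∫⁻ x, ‖x‖ₑ ^ 2 ∂μ ≠ ∞) :
    Integrable (fun x => ‖x‖ ^ 2) μ := by
  refine ⟨by fun_prop, ?_⟩
  rw [hasFiniteIntegral_iff_ofReal (ae_of_all _ fun _ => by positivity)]
  refine lt_of_le_of_lt (lintegral_mono fun x => ?_) h.lt_top
  rw [ENNReal.ofReal_pow (norm_nonneg _), ofReal_norm]

lemma integrable_norm_sq_of_isCompact_support [IsProbabilityMeasure μ]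
    (h : IsCompact μ.support) : Integrable (fun x => ‖x‖ ^ 2) μ := by
  obtain ⟨R, hR⟩ := h.isBounded.exists_norm_le
  refine Integrable.of_bound (by fun_prop) (R ^ 2) ?_
  filter_upwards [Measure.support_mem_ae (μ := μ)] with x hx
  rw [Real.norm_of_nonneg (by positivity)]
  have := hR x hx
  gcongr

end SecondMoment

end SemiDiscrete

open SemiDiscrete in
theorem theorem2 {d n : ℕ}
    (μ ν : Measure (EuclideanSpace ℝ (Fin d))) [IsProbabilityMeasure μ] [IsProbabilityMeasure ν]
    -- `p` is a density of `μ`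
    (p : EuclideanSpace ℝ (Fin d) → ℝ) (hp_meas : Measurable p) (hp_nonneg : ∀ x, 0 ≤ p x)
    (hμ : μ = volume.withDensity (fun x => ENNReal.ofReal (p x)))
    -- `ν` has the distinct atoms `y i` with weights `q i`
    (y : Fin n → EuclideanSpace ℝ (Fin d)) (hy : Function.Injective y)
    (q : Fin n → ℝ) (hq : ∀ i, 0 < q i)
    (hν : ν = ∑ i, ENNReal.ofReal (q i) • Measure.dirac (y i))
    -- the optimal unregularized potentials
    (f g : EuclideanSpace ℝ (Fin d) → ℝ) (hfg : IsOptimalPotentials μ ν f g)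
    -- the regularity assumptions, in general or in concrete form
    (hreg : (RegularSupport μ p ∧ SlicesContinuous p y (fun i => g (y i))) ∨
      RegularDensity μ p y (fun i => g (y i)))
    -- the entropic optimal plans
    (γ : ℝ → Measure (EuclideanSpace ℝ (Fin d) × EuclideanSpace ℝ (Fin d)))
    (hγ : ∀ η, 0 < η → IsEntropicPlan μ ν η (γ η)) :
    -- all quantities are finite
    wassersteinSq μ ν ≠ ∞ ∧
    (∀ η, 0 < η → Integrable (fun z => ‖z.1 - z.2‖ ^ 2) (γ η) ∧
      InformationTheory.klDiv (γ η) (μ.prod ν) ≠ ∞) ∧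
    (∀ i j, i ≠ j → boundaryMass p y (fun k => g (y k)) i j ≠ ∞ ∧
      sliceMass p y (fun k => g (y k)) i j 0 0 ≠ ∞) ∧
    -- the expansion of the entropic cost
    ((fun η : ℝ =>
      ((∫ z, ‖z.1 - z.2‖ ^ 2 ∂(γ η)) +
          η⁻¹ * (InformationTheory.klDiv (γ η) (μ.prod ν)).toReal) -
        ((wassersteinSq μ ν).toReal + shannonEntropy q / η -
          (riemannZeta 2).re / (2 * η ^ 2) * ∑ i, ∑ j ∈ Finset.Ioi i,
            (boundaryMass p y (fun k => g (y k)) i j).toReal / ‖y i - y j‖))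
      =o[atTop] (fun η : ℝ => (η ^ 2)⁻¹)) ∧
    -- the limit of the rescaled value of the auxiliary dual problem
    Tendsto (fun η : ℝ => η * auxValue μ y q (fun k => g (y k)) η) atTop
      (𝓝 ((riemannZeta 2).re / 2 * ∑ i, ∑ j ∈ Finset.Ioi i,
        (sliceMass p y (fun k => g (y k)) i j 0 0).toReal / ‖y i - y j‖)) := by
  have hne : Nonempty (Fin n) := by
    by_contra hempty
    rw [not_nonempty_iff] at hempty
    have h1 := sum_weights_eq_one hν hq
    simp at h1
  have hac : μ ≪ volume := hμ ▸ withDensity_absolutelyContinuous _ _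
  set G : Fin n → ℝ := fun k => g (y k) with hG
  have h2 : Integrable (fun x => ‖x‖ ^ 2) μ := by
    rcases hreg with ⟨h, -⟩ | h
    · exact integrable_norm_sq_of_lintegral h.secondMoment
    · exact integrable_norm_sq_of_isCompact_support h.compact
  have hν2 : Integrable (fun x => ‖x‖ ^ 2) ν := integrable_of_atomic hν _
  have hcell : ∀ i, μ.real (powerCell y G i) = q i :=
    hfg.measureReal_powerCell hq hν h2 hy hac
  have hfib : ∀ i, (mapFibre y G i).Nonempty := fun i =>
    mapFibre_nonempty hy fun h0 => (hq i).ne' <| by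
      rw [← hcell i, measureReal_def, hac h0, ENNReal.toReal_zero]
  have hslices : SlicesContinuous p y G := by
    rcases hreg with ⟨-, h⟩ | h
    · exact h
    · exact h.slicesContinuous hp_meas hy hfib
  have hgsum : ∑ i, q i * G i = 0 := by
    rw [← integral_of_atomic hν hq g]; exact hfg.normalized
  have hcost : ∀ η, 0 < η → Integrable (fun z => ‖z.1 - z.2‖ ^ 2) (γ η) := fun η hη =>
    integrable_cost (hγ η hη).mem_couplings h2 hν2
  have hval := fun η (hη : 0 < η) =>
    (hγ η hη).cost_eq_auxValue hy hq hν hac h2 hcell hgsum hη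
  have hWle : ∀ η, 0 < η → wassersteinSq μ ν ≤
      ENNReal.ofReal (∫ z, ‖z.1 - z.2‖ ^ 2 ∂(γ η)) := fun η hη => by
    rw [← transportCost_eq_ofReal (hcost η hη)]
    exact iInf₂_le _ (hγ η hη).mem_couplings
  have hWfin : wassersteinSq μ ν ≠ ∞ :=
    ne_top_of_le_ne_top ENNReal.ofReal_ne_top (hWle 1 one_pos)
  have hW : (wassersteinSq μ ν).toReal = ∫ x, cTransform y G x ∂μ := by
    refine le_antisymm ?_ ((ENNReal.ofReal_le_iff_le_toReal hWfin).1
      (ofReal_integral_cTransform_le hq hν h2 hfg.normalized))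
    -- The reverse inequality comes from the entropic plans themselves: `Φ` and the divergence are
    -- nonnegative, so their transport cost is at most `∫ cTransform + H(ν) / η`.
    have hlim : Tendsto (fun η : ℝ => ∫ x, cTransform y G x ∂μ + shannonEntropy q / η) atTop
        (𝓝 (∫ x, cTransform y G x ∂μ)) := by
      simpa using tendsto_const_nhds.add
        ((tendsto_const_nhds (x := shannonEntropy q)).div_atTop tendsto_id)
    refine ge_of_tendsto hlim ?_
    filter_upwards [eventually_gt_atTop 0] with η hη
    have h1 : (wassersteinSq μ ν).toReal ≤ ∫ z, ‖z.1 - z.2‖ ^ 2 ∂(γ η) :=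
      ENNReal.toReal_le_of_le_ofReal (integral_nonneg fun _ => by positivity) (hWle η hη)
    have h3 : 0 ≤ η⁻¹ * (InformationTheory.klDiv (γ η) (μ.prod ν)).toReal := by positivity
    have h4 : 0 ≤ auxValue μ y q G η / η := div_nonneg (auxValue_nonneg η) hη.le
    linarith [(hval η hη).2]
  have hslice0 : ∀ i j, i ≠ j → sliceMass p y G i j 0 0 ≠ ∞ := fun i j hij =>
    ((hslices i j hij).1.self_of_nhdsWithin Set.self_mem_Ici).1
  have hlim := tendsto_mul_auxValue (q := q) hy hp_meas hμ hslices
  refine ⟨hWfin, fun η hη => ⟨hcost η hη, (hval η hη).1⟩, fun i j hij =>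
    ⟨by rw [boundaryMass_eq_sliceMass hfib]; exact hslice0 i j hij, hslice0 i j hij⟩, ?_, hlim⟩
  simp_rw [boundaryMass_eq_sliceMass hfib]
  set L := (riemannZeta 2).re / 2 * ∑ i, ∑ j ∈ Finset.Ioi i,
    (sliceMass p y G i j 0 0).toReal / ‖y i - y j‖ with hL
  -- The error in the expansion is exactly `-(η Φ(η) - L) / η²`.
  have hzero : Tendsto (fun η : ℝ => -(η * auxValue μ y q G η - L)) atTop (𝓝 0) := by
    simpa using (hlim.sub_const L).neg
  have hlittle := ((Asymptotics.isLittleO_one_iff ℝ).2 hzero).mul_isBigO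
    (Asymptotics.isBigO_refl (fun η : ℝ => (η ^ 2)⁻¹) atTop)
  simp only [one_mul] at hlittle
  refine hlittle.congr' ?_ EventuallyEq.rfl
  filter_upwards [eventually_gt_atTop 0] with η hη
  rw [(hval η hη).2, hW, hL]
  field_simp
  ring
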